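/- **Setting.** Let $\Lambda=\mathbb T^3=(\mathbb R/2\pi\mathbb Z)^3$ with normalized measure, and $\mathbb N=\{1,2,\dots\}$. A density matrix of order $k$ is a function $\sigma^{(k)}\in L^2(\Lambda^k\times\Lambda^k)$, with Fourier transform, for $\vec\xi_k=(\xi_1,\dots,\xi_k)$, $\vec\xi'_k=(\xi'_1,\dots,\xi'_k)\in(\mathbb Z^3)^k$, $$\widehat\sigma^{(k)}(\vec\xi_k;\vec\xi'_k)=\int \sigma^{(k)}(\vec x_k;\vec x'_k)\,e^{-i\sum_j\langle x_j,\xi_j\rangle+i\sum_j\langle x'_j,\xi'_j\rangle}\,d\vec x_k\,d\vec x'_k .$$ Put $\|\sigma^{(k)}\|_{H^\alpha}=\big(\sum_{\vec\xi_k,\vec\xi'_k}\prod_j\langle\xi_j\rangle^{2\alpha}\langle\xi'_j\rangle^{2\alpha}|\widehat\sigma^{(k)}(\vec\xi_k;\vec\xi'_k)|^2\big)^{1/2}$ with $\langle x\rangle=\sqrt{1+|x|^2}$, and let $\mathcal U^{(k)}(t)$ be the free evolution, which multiplies $\widehat\sigma^{(k)}(\vec\xi_k;\vec\xi'_k)$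 by $e^{-it\sum_j(|\xi_j|^2-|\xi'_j|^2)}$. Let $(h_\zeta)_{\zeta\in\mathbb Z^3}$ be independent random variables on a probability space $\Omega$, each equal to $\pm1$ with probability $\frac12$. A random density matrix of order $k$ is an element of $L^2(\Omega;L^2(\Lambda^k\times\Lambda^k))$. The randomized collision operator is $[B^{(k+1)}]^\omega=\sum_{j=1}^k([B^+_{j,k+1}]^\omega-[B^-_{j,k+1}]^\omega)$, where $$([B_{j,k+1}^+]^\omega\sigma)^\wedge(\vec\xi_k;\vec\xi_k')=\sum_{\mu,\mu'\in\mathbb Z^3}h_{\xi_j}h_{\xi_j-\mu+\mu'}h_{\mu}h_{\mu'}\,\widehat\sigma(\xi_1,\dots,\xi_j-\mu+\mu',\dots,\xi_k,\mu;\ \vec\xi_k',\mu'),$$ $$([B_{j,k+1}^-]^\omega\sigma)^\wedge(\vec\xi_k;\vec\xi_k')=\sum_{\mu,\mu'\in\mathbb Z^3}h_{\xi'_j}h_{\xi'_j-\mu'+\mu}h_{\mu}h_{\mu'}\,\widehat\sigma(\vec\xi_k,\mu;\ \xi'_1,\dots,\xi'_j-\mu'+\mu,\dots,\xi'_k,\mu').$$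 Each series is understood as an unconditionally convergent series in $L^2(\Omega)$, and $[B^{(k+1)}]^\omega$ is defined on those random density matrices of order $k+1$ for which all these series converge and their sums are the Fourier transforms of random density matrices of order $k$. For sequences of density matrices put $$\|\Sigma\|_{\mathcal H^\alpha_\xi}=\sum_{k\in\mathbb N}\xi^k\|\sigma^{(k)}\|_{H^\alpha},\qquad \|\Sigma\|_{L^2(\Omega)\mathcal H^\alpha_\xi}=\sum_{k\in\mathbb N}\xi^k\|\sigma^{(k)}\|_{L^2(\Omega)H^\alpha},$$ and let $\|\Sigma\|_{L^\infty_{t\in I}L^2(\Omega)\mathcal H^\alpha_\xi}$ be the essential supremum over $t\in I$ of $\|\Sigma(t)\|_{L^2(\Omega)\mathcal H^\alpha_\xi}$. The non-resonant class $\mathcal N$ (for the regularity $\alpha$) consists of the sequences $(\sigma^{(m)})_{m\in\mathbb N}$ of density matrices such that, for all $m$, $\widehat\sigma^{(m)}(\xi_1,\dots,\xi_m;\xi_1',\dots,\xi_m')=0$ unless $|\xi_1|>\dots>|\xi_m|>|\xi'_1|>\dots>|\xi'_m|$, and such that there is $C>0$ with $\|\sigma^{(m)}\|_{H^\alpha}\le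 C^m$ for all $m$. For deterministic $\Gamma(0)=(\gamma_0^{(k)})_k$ let $\mathrm{Duh}_0^\omega(\Gamma(0))^{(k)}(t)=\mathcal U^{(k)}(t)\gamma_0^{(k)}$ and, for $j\ge1$, $$\mathrm{Duh}_j^\omega(\Gamma(0))^{(k)}(t)=(-i)^j\int_0^t\!\int_0^{t_1}\!\!\cdots\!\int_0^{t_{j-1}}\mathcal U^{(k)}(t-t_1)[B^{(k+1)}]^\omega\,\mathcal U^{(k+1)}(t_1-t_2)[B^{(k+2)}]^\omega\cdots[B^{(k+j)}]^\omega\,\mathcal U^{(k+j)}(t_j)\gamma_0^{(k+j)}\,dt_j\cdots dt_1 .$$ The truncated solution $[\Gamma_N]^\omega$ has the components $[\gamma_N^{(k)}]^\omega(t)=\sum_{j=0}^{N-k}\mathrm{Duh}_j^\omega(\Gamma(0))^{(k)}(t)$ for $k\le N$ and $[\gamma_N^{(k)}]^\omega=0$ for $k>N$. Time integrals are Bochner integrals in $L^2(\Omega;L^2(\Lambda^k\times\Lambda^k))$. Write $(\mathcal U(t)\Sigma)^{(k)}=\mathcal U^{(k)}(t)\sigma^{(k)}$ and $([\widehat B]^\omega\Sigma)^{(k)}=[B^{(k+1)}]^\omega\sigma^{(k+1)}$.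 **Theorem.** Let $\alpha\ge0$. There are constants $C_1,C_2>0$, depending only on $\alpha$, such that the following holds. Let $0<\xi<\xi'$ and $T>0$ satisfy $$\frac{C_1T}{\xi'}<1,\qquad \frac{C_2\,\xi}{\xi'}<1,$$ put $I=[0,T]$, and let $\Gamma(0)=(\gamma_0^{(k)})_k\in\mathcal H^\alpha_{\xi'}\cap\mathcal N$, i.e. $\Gamma(0)\in\mathcal N$ and $\|\Gamma(0)\|_{\mathcal H^\alpha_{\xi'}}<\infty$. Then all the Duhamel terms of $\Gamma(0)$ are well defined: each collision operator in them is applied to an element of its domain, and the integrands depend continuously on the times, as elements of $L^2(\Omega;L^2(\Lambda^k\times\Lambda^k))$. Moreover, there is $[\Gamma]^\omega\in L^\infty_{t\in I}L^2(\Omega)\mathcal H^\alpha_\xi$ with the following properties. 1. $[\Gamma_N]^\omega\to[\Gamma]^\omega$ in $L^\infty_{t\in I}L^2(\Omega)\mathcal H^\alpha_\xi$ as $N\to\infty$. 2. $\|[\Gamma]^\omega\|_{L^\infty_{t\in I}L^2(\Omega)\mathcal H^\alpha_\xi}\le K\,\|\Gamma(0)\|_{\mathcal H^\alpha_{\xi'}}$,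 where $K$ depends only on $\xi,\xi',\alpha$. 3. For almost every $t\in I$ and all $k\in\mathbb N$, $([\Gamma]^\omega(t))^{(k+1)}$ lies in the domain of $[B^{(k+1)}]^\omega$; for all $t\in I$ and $k\in\mathbb N$, the map $s\mapsto\big(\mathcal U(t-s)[\widehat B]^\omega[\Gamma]^\omega(s)\big)^{(k)}$ is Bochner integrable on $[0,t]$; and for every $\xi_0>0$, $$\Big\|[\Gamma]^\omega(t)-\mathcal U(t)\Gamma(0)+i\int_0^t\mathcal U(t-s)[\widehat B]^\omega[\Gamma]^\omega(s)\,ds\Big\|_{L^\infty_{t\in I}L^2(\Omega)\mathcal H^\alpha_{\xi_0}}=0 .$$ In particular, for almost every $t\in I$ one has, for all $k\in\mathbb N$, $$\Big\|\Big([\Gamma]^\omega(t)-\mathcal U(t)\Gamma(0)+i\int_0^t\mathcal U(t-s)[\widehat B]^\omega[\Gamma]^\omega(s)\,ds\Big)^{(k)}\Big\|_{L^2(\Omega)H^\alpha(\Lambda^k\times\Lambda^k)}=0 .$$ -/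

import Mathlib

open MeasureTheory ProbabilityTheory Filter Topology UnitAddTorus
open scoped ENNReal NNReal

universe u

namespace RandGP

noncomputable section

/-! ### Frequencies and density matrices -/

/-- Frequencies on the three-dimensional torus. -/
abbrev Z3 : Type := Fin 3 → ℤ

/-- The squared Euclidean length `|ζ|²` of a frequency. -/
def freqSq (ζ : Z3) : ℤ := ∑ a, ζ a ^ 2

/-- The Japanese bracket `⟨ζ⟩ = √(1 + |ζ|²)`. -/
def bracket (ζ : Z3) : ℝ := Real.sqrt (1 + (freqSq ζ : ℝ))

/-- The coordinates of a point `(x₁, …, x_k; x'₁, …, x'_k)` of `Λ^k × Λ^k`, with `Λ = 𝕋³`: the left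
summand enumerates the coordinates of the `x_j`, the right one those of the `x'_j`. -/
abbrev Coord (k : ℕ) : Type := (Fin k × Fin 3) ⊕ (Fin k × Fin 3)

/-- Square-integrable density matrices of order `k` on `𝕋³`, i.e. `L²(Λ^k × Λ^k)`.
The torus `ℝ/2πℤ`, with normalized measure, is parametrized by `ℝ/ℤ` through `x ↦ 2πx`, so that the
character of frequency `n` is Mathlib's `fourier n`. -/
abbrev DM (k : ℕ) : Type :=
  Lp ℂ 2 (Measure.pi fun _ : Coord k => (AddCircle.haarAddCircle : Measure UnitAddCircle))

/-- The integer vector `(ξ, -ξ')`; the primed variables carry the opposite sign. -/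
def freqIndex {k : ℕ} (ξ ξ' : Fin k → Z3) : Coord k → ℤ :=
  Sum.elim (fun p => ξ p.1 p.2) (fun p => -ξ' p.1 p.2)

/-- The Fourier transform of a density matrix:
`σ̂(ξ; ξ') = ∫ σ(x; x') exp(-i ∑ ⟨x_j, ξ_j⟩ + i ∑ ⟨x'_j, ξ'_j⟩) dx dx'`. -/
def dmHat {k : ℕ} (σ : DM k) (ξ ξ' : Fin k → Z3) : ℂ := mFourierCoeff σ (freqIndex ξ ξ')

/-- The Sobolev norm `‖σ‖_{H^α} = ‖S^{(k,α)} σ‖_{L²(Λ^k × Λ^k)}` (possibly infinite), where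
`S^{(k,α)}` multiplies `σ̂(ξ; ξ')` by `∏ ⟨ξ_j⟩^α ∏ ⟨ξ'_j⟩^α`. -/
def hNorm (α : ℝ) {k : ℕ} (σ : DM k) : ℝ≥0∞ :=
  (∑' p : (Fin k → Z3) × (Fin k → Z3),
    ‖(((∏ j, bracket (p.1 j) ^ α) * (∏ j, bracket (p.2 j) ^ α) : ℝ) : ℂ)
      * dmHat σ p.1 p.2‖ₑ ^ (2 : ℝ)) ^ (1 / 2 : ℝ)

/-! ### The free evolution -/

/-- Multiplication by a function of modulus one, as an isometry of `ℓ²`. -/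
def unimodularMul {ι : Type*} (m : ι → Circle) :
    lp (fun _ : ι => ℂ) 2 →ₗᵢ[ℂ] lp (fun _ : ι => ℂ) 2 where
  toFun f := ⟨fun i => (m i : ℂ) * f i,
    (memℓp_gen_iff (by norm_num)).2 (by
      simpa [Circle.norm_coe] using (memℓp_gen_iff (by norm_num)).1 (lp.memℓp f))⟩
  map_add' f g := by
    ext i
    exact mul_add (m i : ℂ) (f i) (g i)
  map_smul' c f := by
    ext i
    exact mul_left_comm (m i : ℂ) c (f i)
  norm_map' f := by
    rw [lp.norm_eq_tsum_rpow (by norm_num), lp.norm_eq_tsum_rpow (by norm_num)]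
    simp only [LinearMap.coe_mk, AddHom.coe_mk, norm_mul, Circle.norm_coe, one_mul]

theorem unimodularMul_apply {ι : Type*} (m : ι → Circle) (f : lp (fun _ : ι => ℂ) 2) (i : ι) :
    unimodularMul m f i = (m i : ℂ) * f i := rfl

/-- The dispersion relation `∑ |ξ_j|² - ∑ |ξ'_j|²`. -/
def dispersion {k : ℕ} (n : Coord k → ℤ) : ℝ :=
  (∑ p : Fin k × Fin 3, (n (Sum.inl p) : ℝ) ^ 2) - ∑ p : Fin k × Fin 3, (n (Sum.inr p) : ℝ) ^ 2

/-- The free evolution `U^{(k)}(t) σ = e^{it∑Δ_{x_j}} σ e^{-it∑Δ_{x'_j}}`, which multiplies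
`σ̂(ξ; ξ')` by `exp(-it(∑ |ξ_j|² - ∑ |ξ'_j|²))`. -/
def freeEvol (k : ℕ) (t : ℝ) : DM k →L[ℂ] DM k :=
  (((mFourierBasis (d := Coord k)).repr.symm.toLinearIsometry.comp
    ((unimodularMul fun n : Coord k → ℤ => Circle.exp (-(t * dispersion n))).comp
      (mFourierBasis (d := Coord k)).repr.toLinearIsometry)).toContinuousLinearMap :)

theorem dmHat_freeEvol {k : ℕ} (t : ℝ) (σ : DM k) (ξ ξ' : Fin k → Z3) :
    dmHat (freeEvol k t σ) ξ ξ' =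
      Complex.exp ((-(t * ((∑ j, (freqSq (ξ j) : ℝ)) - ∑ j, (freqSq (ξ' j) : ℝ))) : ℝ)
        * Complex.I) * dmHat σ ξ ξ' := by
  have hd : dispersion (freqIndex ξ ξ')
      = (∑ j, (freqSq (ξ j) : ℝ)) - ∑ j, (freqSq (ξ' j) : ℝ) := by
    simp [dispersion, freqIndex, freqSq, Fintype.sum_prod_type]
  have h1 := mFourierBasis_repr (freeEvol k t σ) (freqIndex ξ ξ')
  have h2 := mFourierBasis_repr σ (freqIndex ξ ξ')
  unfold dmHat
  refine h1.symm.trans ?_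
  refine Eq.trans ?_ (congrArg _ h2)
  rw [← hd, ← Circle.coe_exp, ← unimodularMul_apply
    (fun n : Coord k → ℤ => Circle.exp (-(t * dispersion n)))]
  exact congrArg (fun f : lp (fun _ : Coord k → ℤ => ℂ) 2 => f (freqIndex ξ ξ'))
    ((mFourierBasis (d := Coord k)).repr.apply_symm_apply _)

/-! ### Random density matrices -/

section Random

variable {Ω : Type u} [MeasurableSpace Ω] (P : Measure Ω)

/-- Independent random variables `h_ζ`, `ζ ∈ ℤ³`, each taking the values `1` and `-1` with
probability `1/2`. -/
structure IsBernoulliFamily (h : Z3 → Ω → ℝ) : Prop where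
  measurable : ∀ ζ, Measurable (h ζ)
  indep : iIndepFun h P
  prob_one : ∀ ζ, P {ω | h ζ ω = 1} = 1 / 2
  prob_neg_one : ∀ ζ, P {ω | h ζ ω = -1} = 1 / 2

/-- Density matrices of order `k` depending on the random parameter:
`L²(Ω; L²(Λ^k × Λ^k)) = L²(Ω × Λ^k × Λ^k)`. -/
abbrev RDM (k : ℕ) : Type u := Lp (DM k) 2 P

variable {P}

/-- The norm of `L²(Ω) H^α(Λ^k × Λ^k)` (possibly infinite): first the `H^α` norm, then the
`L²(Ω)` norm. -/
def rNorm (α : ℝ) {k : ℕ} (σ : RDM P k) : ℝ≥0∞ :=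
  (∫⁻ ω, hNorm α (σ ω) ^ (2 : ℝ) ∂P) ^ (1 / 2 : ℝ)

/-- The free evolution acting on random density matrices, for each value of the parameter. -/
def freeEvolR (k : ℕ) (t : ℝ) : RDM P k →L[ℂ] RDM P k := (freeEvol k t).compLpL 2 P

/-- A deterministic density matrix, as a random one. -/
def constR [IsProbabilityMeasure P] {k : ℕ} (σ : DM k) : RDM P k :=
  (memLp_const σ : MemLp (fun _ : Ω => σ) 2 P).toLp

/-! ### The randomized collision operator

The series that define the operator are taken over pairs of frequencies
`(μ, μ') = (ξ_{k+1}, ξ'_{k+1})` and converge (unconditionally) in `L²(Ω)`. -/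

/-- The term with index `(μ, μ')` of the series for `([B_{j,k+1}^+]^ω σ)^(ξ; ξ')`. -/
def plusTerm (h : Z3 → Ω → ℝ) {k : ℕ} (j : Fin k) (σ : RDM P (k + 1)) (ξ ξ' : Fin k → Z3)
    (q : Z3 × Z3) (ω : Ω) : ℂ :=
  ((h (ξ j) ω * h (ξ j - q.1 + q.2) ω * h q.1 ω * h q.2 ω : ℝ) : ℂ)
    * dmHat (σ ω) (Fin.snoc (α := fun _ => Z3) (Function.update ξ j (ξ j - q.1 + q.2)) q.1)
        (Fin.snoc (α := fun _ => Z3) ξ' q.2)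

/-- The term with index `(μ, μ')` of the series for `([B_{j,k+1}^-]^ω σ)^(ξ; ξ')`. -/
def minusTerm (h : Z3 → Ω → ℝ) {k : ℕ} (j : Fin k) (σ : RDM P (k + 1)) (ξ ξ' : Fin k → Z3)
    (q : Z3 × Z3) (ω : Ω) : ℂ :=
  ((h (ξ' j) ω * h (ξ' j - q.2 + q.1) ω * h q.1 ω * h q.2 ω : ℝ) : ℂ)
    * dmHat (σ ω) (Fin.snoc (α := fun _ => Z3) ξ q.1)
        (Fin.snoc (α := fun _ => Z3) (Function.update ξ' j (ξ' j - q.2 + q.1)) q.2)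

/-- The series `∑_q F q` of random variables converges unconditionally in `L²(Ω)` to `S`. -/
def HasSumL2 (P : Measure Ω) (F : Z3 × Z3 → Ω → ℂ) (S : Ω → ℂ) : Prop :=
  Tendsto (fun A : Finset (Z3 × Z3) => eLpNorm (fun ω => (∑ q ∈ A, F q ω) - S ω) 2 P) atTop (𝓝 0)

/-- `τ = [B_{j,k+1}^+]^ω σ`. -/
def IsCollisionPlus (h : Z3 → Ω → ℝ) {k : ℕ} (j : Fin k) (σ : RDM P (k + 1)) (τ : RDM P k) :
    Prop :=
  ∀ ξ ξ' : Fin k → Z3, HasSumL2 P (plusTerm h j σ ξ ξ') (fun ω => dmHat (τ ω) ξ ξ')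

/-- `τ = [B_{j,k+1}^-]^ω σ`. -/
def IsCollisionMinus (h : Z3 → Ω → ℝ) {k : ℕ} (j : Fin k) (σ : RDM P (k + 1)) (τ : RDM P k) :
    Prop :=
  ∀ ξ ξ' : Fin k → Z3, HasSumL2 P (minusTerm h j σ ξ ξ') (fun ω => dmHat (τ ω) ξ ξ')

/-- `τ = [B^{(k+1)}]^ω σ = ∑_{j=1}^k ([B_{j,k+1}^+]^ω σ - [B_{j,k+1}^-]^ω σ)`. -/
def IsCollision (h : Z3 → Ω → ℝ) {k : ℕ} (σ : RDM P (k + 1)) (τ : RDM P k) : Prop :=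
  ∃ τp τm : Fin k → RDM P k, (∀ j, IsCollisionPlus h j σ (τp j)) ∧
    (∀ j, IsCollisionMinus h j σ (τm j)) ∧ τ = ∑ j, (τp j - τm j)

/-- The domain of `[B^{(k+1)}]^ω`. -/
def CollisionDefined (h : Z3 → Ω → ℝ) {k : ℕ} (σ : RDM P (k + 1)) : Prop :=
  ∃ τ : RDM P k, IsCollision h σ τ

open Classical in
/-- The full randomized collision operator `[B^{(k+1)}]^ω` (with value `0` off its domain). -/
def collision (h : Z3 → Ω → ℝ) (k : ℕ) (σ : RDM P (k + 1)) : RDM P k :=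
  if hσ : CollisionDefined h σ then Classical.choose hσ else 0

/-! ### Sequences of density matrices. Only the entries of order `k ≥ 1` are relevant. -/

/-- The norm of `H_ξ^α`: `∑_{k ≥ 1} ξ^k ‖σ^{(k)}‖_{H^α}`. -/
def seqNorm (α ξ : ℝ) (Γ₀ : ∀ k, DM k) : ℝ≥0∞ :=
  ∑' k : ℕ, ENNReal.ofReal ξ ^ (k + 1) * hNorm α (Γ₀ (k + 1))

/-- The norm of `L²(Ω) H_ξ^α`: `∑_{k ≥ 1} ξ^k ‖σ^{(k)}‖_{L²(Ω) H^α}`. -/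
def seqNormR (α ξ : ℝ) (Γ : ∀ k, RDM P k) : ℝ≥0∞ :=
  ∑' k : ℕ, ENNReal.ofReal ξ ^ (k + 1) * rNorm α (Γ (k + 1))

/-- The norm of `L^∞_{t ∈ [0,T]} L²(Ω) H_ξ^α`. -/
def timeNorm (T α ξ : ℝ) (Γ : ℝ → ∀ k, RDM P k) : ℝ≥0∞ :=
  essSup (fun t => seqNormR α ξ (Γ t)) (volume.restrict (Set.Icc 0 T))

/-- Membership in `L^∞_{t ∈ [0,T]} L²(Ω) H_ξ^α`. -/
def MemTimeSpace (T α ξ : ℝ) (Γ : ℝ → ∀ k, RDM P k) : Prop :=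
  (∀ k, 1 ≤ k → AEStronglyMeasurable (fun t => Γ t k) (volume.restrict (Set.Icc 0 T))) ∧
    timeNorm T α ξ Γ < ∞

/-- The non-resonant class `𝒩`, for the regularity `α`: the Fourier transform of the entry of
order `m` is supported on `|ξ₁| > ⋯ > |ξ_m| > |ξ'₁| > ⋯ > |ξ'_m|`, and its `H^α` norm is at most
`C^m`. -/
def NonResonant (α : ℝ) (Γ₀ : ∀ k, DM k) : Prop :=
  (∀ m, 1 ≤ m → ∀ ξ ξ' : Fin m → Z3,
      ¬ StrictAnti (fun i => freqSq (Fin.append ξ ξ' i)) → dmHat (Γ₀ m) ξ ξ' = 0) ∧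
    ∃ C : ℝ, 0 < C ∧ ∀ m, 1 ≤ m → hNorm α (Γ₀ m) ≤ ENNReal.ofReal C ^ m

/-! ### Duhamel expansions -/

/-- The integrand of the Duhamel expansion of length `j`, at the times `s = (s₀, …, s_j)`:
`U^{(k)}(s₀ - s₁) [B^{(k+1)}]^ω U^{(k+1)}(s₁ - s₂) ⋯ [B^{(k+j)}]^ω U^{(k+j)}(s_j) γ₀^{(k+j)}`. -/
def duhIntegrand [IsProbabilityMeasure P] (h : Z3 → Ω → ℝ) (Γ₀ : ∀ k, DM k) :
    (j k : ℕ) → (Fin (j + 1) → ℝ) → RDM P k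
  | 0, k, s => freeEvolR k (s 0) (constR (Γ₀ k))
  | j + 1, k, s => freeEvolR k (s 0 - s 1)
      (collision h k (duhIntegrand h Γ₀ j (k + 1) (fun i => s i.succ)))

/-- The iterated integral `∫_0^t ∫_0^{t₁} ⋯ ∫_0^{t_{j-1}} f(t₁, …, t_j) dt_j ⋯ dt₁`. -/
def simplexIntegral {E : Type*} [NormedAddCommGroup E] [NormedSpace ℝ E] :
    (j : ℕ) → ℝ → ((Fin j → ℝ) → E) → E
  | 0, _, f => f Fin.elim0
  | j + 1, t, f => ∫ t₁ in (0 : ℝ)..t,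
      simplexIntegral j t₁ (fun s => f (Fin.cons (α := fun _ => ℝ) t₁ s))

/-- The Duhamel term `Duh_j^ω(Γ(0))^{(k)}(t)`. -/
def duh [IsProbabilityMeasure P] (h : Z3 → Ω → ℝ) (Γ₀ : ∀ k, DM k) (j k : ℕ) (t : ℝ) :
    RDM P k :=
  (-Complex.I) ^ j • simplexIntegral j t
    (fun s => duhIntegrand h Γ₀ j k (Fin.cons (α := fun _ => ℝ) t s))

/-- The Duhamel expansions of `Γ(0)` are meaningful: every collision operator that occurs in them
acts on an element of its domain, and the integrands are continuous in the time variables. -/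
def DuhamelDefined [IsProbabilityMeasure P] (h : Z3 → Ω → ℝ) (Γ₀ : ∀ k, DM k) : Prop :=
  ∀ j k : ℕ, 1 ≤ k →
    (∀ s, CollisionDefined (P := P) h (duhIntegrand h Γ₀ j (k + 1) s)) ∧
    Continuous (fun s => (duhIntegrand h Γ₀ j k s : RDM P k))

/-- The solution `[Γ_N]^ω` of the truncated hierarchy: `∑_{j=0}^{N-k} Duh_j^ω(Γ(0))^{(k)}(t)` for
`k ≤ N`, and `0` for `k > N`. -/
def truncated [IsProbabilityMeasure P] (h : Z3 → Ω → ℝ) (Γ₀ : ∀ k, DM k) (N : ℕ) (t : ℝ)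
    (k : ℕ) : RDM P k :=
  if k ≤ N then ∑ j ∈ Finset.range (N - k + 1), duh h Γ₀ j k t else 0

/-- The collision term of the Duhamel formula is meaningful: `[B^{(k+1)}]^ω` may be applied to
`Γ^{(k+1)}(t)` for almost every `t ∈ [0,T]`, and `s ↦ U^{(k)}(t-s) [B^{(k+1)}]^ω Γ^{(k+1)}(s)` is
Bochner integrable on `[0,t]` for every `t ∈ [0,T]`. -/
def CollisionTermDefined (h : Z3 → Ω → ℝ) (T : ℝ) (Γ : ℝ → ∀ k, RDM P k) : Prop :=
  (∀ᵐ t ∂(volume.restrict (Set.Icc 0 T)), ∀ k, 1 ≤ k → CollisionDefined h (Γ t (k + 1))) ∧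
    ∀ t ∈ Set.Icc 0 T, ∀ k, 1 ≤ k →
      IntervalIntegrable (fun s => freeEvolR k (t - s) (collision h k (Γ s (k + 1)))) volume 0 t

/-- The defect in the Duhamel formula,
`(Γ(t) - U(t) Γ(0) + i ∫_0^t U(t-s) [B̂]^ω Γ(s) ds)^{(k)}`. -/
def defect [IsProbabilityMeasure P] (h : Z3 → Ω → ℝ) (Γ₀ : ∀ k, DM k) (Γ : ℝ → ∀ k, RDM P k)
    (t : ℝ) (k : ℕ) : RDM P k :=
  Γ t k - freeEvolR k t (constR (Γ₀ k))
    + Complex.I • ∫ s in (0 : ℝ)..t, freeEvolR k (t - s) (collision h k (Γ s (k + 1)))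

end Random

end

end RandGP

/-! For a frequency `p` of order `k` let S(p) be the product of the signs h_ζ over its 2k
components. Since signs square to one, the four signs in a term of the collision series turn S of
the input frequency into S of the output frequency. Consider random density matrices with Fourier
transform S(p) ∑_A h_A c_A(p) / `weight α p`, where A runs over finite sets of frequencies and h_A
is the Walsh function of A. On these the randomized collision operator carries no sign at all: it
pushes each c_A forward along the collapse of frequencies, without mixing different A. The free
evolution multiplies c_A by phases, so the whole dynamics is diagonal in A.

Non-resonance enters only through the data. The components of a non-resonant `p` are distinct, so
S(p) h_A = 1 when A is their set; and the strict ordering allows `p` to be recovered from A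
(`freqSet_injective`). Hence the data have the above form, with every c_A supported on at most one
frequency (`exists_amp`).

Amplitudes are measured in ℓ² over A with values in ℓ¹ over `p`. For the data this is exactly the
H^α norm, an ℓ¹ norm with one term being an absolute value. In general it dominates the L²(Ω)H^α
norm, by orthonormality of the Walsh functions and ℓ¹ ⊂ ℓ² (`rNorm_realize_le`). A push-forward is
bounded on ℓ¹ however many frequencies are identified, and the weights cost at most √3^α = `growth
α`. Thus the collision operator from order k+1 to k has norm at most 2 · `growth α` · k on
amplitudes (`norm_ampCollision_le`).

The rest is a power series. The j-th Duhamel term of order k is at most (2 · `growth α` · t)^j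
binom(k+j, j) ‖Y (k+j)‖ (`norm_ampDuh_le`), and the binomial is at most 2^(k+j). The factor 2^j is
absorbed by the smallness of T/ξ', the factor 2^k by that of ξ/ξ'. All remainders are then
controlled by tails of the norm of the data (`enorm_tail_le`). -/

namespace RandGP

noncomputable section

/-! ### Operators on `ℓ¹` and on `ℓ²`-direct sums -/

section SequenceSpaces

variable {ι : Type*} {E F : Type*} [NormedAddCommGroup E] [NormedSpace ℂ E]
  [NormedAddCommGroup F] [NormedSpace ℂ F]

theorem summable_norm_lpOne (x : lp (fun _ : ι => ℂ) 1) : Summable fun i => ‖x i‖ := by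
  simpa using (lp.memℓp x).summable (by norm_num)

theorem norm_lpOne (x : lp (fun _ : ι => ℂ) 1) : ‖x‖ = ∑' i, ‖x i‖ := by
  simpa using lp.norm_eq_tsum_rpow (p := 1) (by norm_num) x

theorem norm_smul_le_of_bound {φ : ι → F} {C : ℝ} (hφ : ∀ i, ‖φ i‖ ≤ C)
    (x : lp (fun _ : ι => ℂ) 1) (i : ι) : ‖x i • φ i‖ ≤ C * ‖x i‖ := by
  rw [norm_smul, mul_comm]
  exact mul_le_mul_of_nonneg_right (hφ i) (norm_nonneg _)

theorem summable_smul_of_bound [CompleteSpace F] {φ : ι → F} {C : ℝ} (hφ : ∀ i, ‖φ i‖ ≤ C)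
    (x : lp (fun _ : ι => ℂ) 1) : Summable fun i => x i • φ i :=
  Summable.of_norm_bounded ((summable_norm_lpOne x).mul_left C) (norm_smul_le_of_bound hφ x)

/-- The operator `ℓ¹ → F` that sends the unit vectors to a given bounded family. -/
def lpOneLift [CompleteSpace F] (φ : ι → F) (C : ℝ) (hφ : ∀ i, ‖φ i‖ ≤ C) :
    lp (fun _ : ι => ℂ) 1 →L[ℂ] F :=
  LinearMap.mkContinuous
    { toFun := fun x => ∑' i, x i • φ i
      map_add' := fun x y => by
        rw [← (summable_smul_of_bound hφ x).tsum_add (summable_smul_of_bound hφ y)]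
        exact tsum_congr fun i => by rw [lp.coeFn_add, Pi.add_apply, add_smul]
      map_smul' := fun c x => by
        rw [RingHom.id_apply, ← (summable_smul_of_bound hφ x).tsum_const_smul c]
        exact tsum_congr fun i => by
          rw [lp.coeFn_smul, Pi.smul_apply, smul_eq_mul, mul_smul] }
    C fun x => by
      rw [norm_lpOne, ← tsum_mul_left]
      exact tsum_of_norm_bounded ((summable_norm_lpOne x).mul_left C).hasSum
        (norm_smul_le_of_bound hφ x)

theorem hasSum_lpOneLift [CompleteSpace F] (φ : ι → F) (C : ℝ) (hφ : ∀ i, ‖φ i‖ ≤ C)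
    (x : lp (fun _ : ι => ℂ) 1) : HasSum (fun i => x i • φ i) (lpOneLift φ C hφ x) :=
  (summable_smul_of_bound hφ x).hasSum

theorem norm_lpOneLift_le [CompleteSpace F] (φ : ι → F) {C : ℝ} (hC : 0 ≤ C)
    (hφ : ∀ i, ‖φ i‖ ≤ C) : ‖lpOneLift φ C hφ‖ ≤ C :=
  LinearMap.mkContinuous_norm_le _ hC _

/-- Dominated convergence with majorant `C * ‖x i‖`. It yields strong continuity in time of the free
evolution. -/
theorem tendsto_lpOneLift [CompleteSpace F] {β : Type*} {l : Filter β} {φ : β → ι → F}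
    {φ₀ : ι → F} {C : ℝ} (hφ : ∀ b i, ‖φ b i‖ ≤ C) (hφ₀ : ∀ i, ‖φ₀ i‖ ≤ C)
    (h : ∀ i, Tendsto (fun b => φ b i) l (𝓝 (φ₀ i))) (x : lp (fun _ : ι => ℂ) 1) :
    Tendsto (fun b => lpOneLift (φ b) C (hφ b) x) l (𝓝 (lpOneLift φ₀ C hφ₀ x)) :=
  tendsto_tsum_of_dominated_convergence ((summable_norm_lpOne x).mul_left C)
    (fun i => (h i).const_smul (x i))
    (Eventually.of_forall fun b i => norm_smul_le_of_bound (hφ b) x i)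

omit [NormedSpace ℂ E] in
theorem summable_sq_lpTwo (x : lp (fun _ : ι => E) 2) : Summable fun i => ‖x i‖ ^ 2 := by
  simpa using (lp.memℓp x).summable (by norm_num)

omit [NormedSpace ℂ E] in
theorem norm_sq_lpTwo (x : lp (fun _ : ι => E) 2) : ‖x‖ ^ 2 = ∑' i, ‖x i‖ ^ 2 := by
  simpa using lp.norm_rpow_eq_tsum (p := 2) (by norm_num) x

theorem norm_sq_apply_le (T : E →L[ℂ] F) (v : E) : ‖T v‖ ^ 2 ≤ ‖T‖ ^ 2 * ‖v‖ ^ 2 := by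
  rw [← mul_pow]
  exact pow_le_pow_left₀ (norm_nonneg _) (T.le_opNorm v) 2

/-- An operator acting on every component of an `ℓ²`-direct sum. -/
def lpTwoMap (T : E →L[ℂ] F) : lp (fun _ : ι => E) 2 →L[ℂ] lp (fun _ : ι => F) 2 :=
  LinearMap.mkContinuous
    { toFun := fun x => ⟨fun i => T (x i), memℓp_gen (by
        simpa using Summable.of_nonneg_of_le (fun i => by positivity)
          (fun i => norm_sq_apply_le T (x i)) ((summable_sq_lpTwo x).mul_left (‖T‖ ^ 2)))⟩
      map_add' := fun x y => by
        ext i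
        exact map_add T (x i) (y i)
      map_smul' := fun c x => by
        ext i
        exact map_smul T c (x i) }
    ‖T‖ fun x => by
      refine lp.norm_le_of_tsum_le (by norm_num) (by positivity) ?_
      have h : ∑' i, ‖T (x i)‖ ^ 2 ≤ ∑' i, ‖T‖ ^ 2 * ‖x i‖ ^ 2 :=
        Summable.tsum_le_tsum (fun i => norm_sq_apply_le T (x i))
          (Summable.of_nonneg_of_le (fun i => by positivity)
            (fun i => norm_sq_apply_le T (x i)) ((summable_sq_lpTwo x).mul_left (‖T‖ ^ 2)))
          ((summable_sq_lpTwo x).mul_left (‖T‖ ^ 2))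
      rw [tsum_mul_left, ← norm_sq_lpTwo, ← mul_pow] at h
      simpa using h

theorem lpTwoMap_apply (T : E →L[ℂ] F) (x : lp (fun _ : ι => E) 2) (i : ι) :
    lpTwoMap T x i = T (x i) := rfl

theorem norm_lpTwoMap_le (T : E →L[ℂ] F) : ‖lpTwoMap (ι := ι) T‖ ≤ ‖T‖ :=
  LinearMap.mkContinuous_norm_le _ (norm_nonneg _) _

/-- Dominated convergence with majorant `(2 * C * ‖x i‖) ^ 2`. Only strong convergence is asked for,
which is what the partial sums of a collision series and the free evolution in time provide. -/
theorem tendsto_lpTwoMap {β : Type*} {l : Filter β} {T : β → E →L[ℂ] F} {T₀ : E →L[ℂ] F} {C : ℝ}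
    (hT : ∀ b, ‖T b‖ ≤ C) (hT₀ : ‖T₀‖ ≤ C) (h : ∀ v, Tendsto (fun b => T b v) l (𝓝 (T₀ v)))
    (x : lp (fun _ : ι => E) 2) :
    Tendsto (fun b => lpTwoMap (T b) x) l (𝓝 (lpTwoMap T₀ x)) := by
  have hsq : Tendsto (fun b => ‖lpTwoMap (T b) x - lpTwoMap T₀ x‖ ^ 2) l (𝓝 0) := by
    have h0 : ∑' _ : ι, (0 : ℝ) = 0 := tsum_zero
    simp only [norm_sq_lpTwo]
    rw [← h0]
    refine tendsto_tsum_of_dominated_convergence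
      ((summable_sq_lpTwo x).mul_left ((2 * C) ^ 2)) (fun i => ?_)
      (Eventually.of_forall fun b i => ?_)
    · have h1 := ((h (x i)).sub_const (T₀ (x i))).norm.pow 2
      rw [sub_self, norm_zero, zero_pow two_ne_zero] at h1
      exact h1
    · have h2 : ‖T b (x i) - T₀ (x i)‖ ≤ 2 * C * ‖x i‖ :=
        (norm_sub_le _ _).trans (by
          linarith [(T b).le_of_opNorm_le (hT b) (x i), T₀.le_of_opNorm_le hT₀ (x i)])
      rw [Real.norm_of_nonneg (by positivity), ← mul_pow]
      exact pow_le_pow_left₀ (norm_nonneg _) h2 2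
  rw [tendsto_iff_norm_sub_tendsto_zero]
  have h3 := hsq.sqrt
  simpa [Real.sqrt_sq] using h3

end SequenceSpaces

/-! ### Iterated integrals -/

section Simplex

variable {E F : Type*} [NormedAddCommGroup E] [NormedSpace ℝ E]
  [NormedAddCommGroup F] [NormedSpace ℝ F]

/-- The parameter space `X` is arbitrary because the induction moves the outermost time into it,
passing to `X × ℝ`. -/
theorem continuous_simplexIntegral (j : ℕ) {X : Type*} [TopologicalSpace X]
    [FirstCountableTopology X] {f : X → (Fin j → ℝ) → E} {t : X → ℝ} (ht : Continuous t)
    (hf : Continuous (Function.uncurry f)) :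
    Continuous fun x => simplexIntegral j (t x) (f x) := by
  induction j generalizing X with
  | zero => exact hf.comp (continuous_id.prodMk continuous_const)
  | succ j ih =>
    refine intervalIntegral.continuous_parametric_intervalIntegral_of_continuous
      (f := fun x t₁ => simplexIntegral j t₁ (fun s => f x (Fin.cons (α := fun _ => ℝ) t₁ s)))
      ?_ ht
    refine ih (X := X × ℝ) (t := fun p => p.2)
      (f := fun p s => f p.1 (Fin.cons (α := fun _ => ℝ) p.2 s)) continuous_snd ?_
    exact hf.comp ((continuous_fst.comp continuous_fst).prodMk
      (Continuous.finCons (A := fun _ => ℝ) (continuous_snd.comp continuous_fst) continuous_snd))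

theorem simplexIntegral_comp_clm [CompleteSpace E] [CompleteSpace F] (L : E →L[ℝ] F) (j : ℕ)
    (t : ℝ) {f : (Fin j → ℝ) → E} (hf : Continuous f) :
    simplexIntegral j t (fun s => L (f s)) = L (simplexIntegral j t f) := by
  induction j generalizing t with
  | zero => rfl
  | succ j ih =>
    have hcont : Continuous fun p : ℝ × (Fin j → ℝ) => f (Fin.cons (α := fun _ => ℝ) p.1 p.2) :=
      hf.comp (Continuous.finCons (A := fun _ => ℝ) continuous_fst continuous_snd)
    have hint : Continuous fun t₁ : ℝ =>
        simplexIntegral j t₁ (fun s => f (Fin.cons (α := fun _ => ℝ) t₁ s)) :=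
      continuous_simplexIntegral j (X := ℝ) (t := fun t₁ => t₁)
        (f := fun t₁ s => f (Fin.cons (α := fun _ => ℝ) t₁ s)) continuous_id hcont
    calc ∫ t₁ in (0 : ℝ)..t,
          simplexIntegral j t₁ (fun s => L (f (Fin.cons (α := fun _ => ℝ) t₁ s)))
        = ∫ t₁ in (0 : ℝ)..t,
          L (simplexIntegral j t₁ (fun s => f (Fin.cons (α := fun _ => ℝ) t₁ s))) := by
          refine intervalIntegral.integral_congr fun t₁ _ => ?_
          exact ih t₁ (hcont.comp (continuous_const.prodMk continuous_id))
      _ = _ := L.intervalIntegral_comp_comm (hint.intervalIntegrable _ _)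

end Simplex

/-! ### Fourier coefficients -/

/-- Frequencies `(ξ; ξ')` of density matrices of order `k`. -/
abbrev Freq (k : ℕ) : Type := (Fin k → Z3) × (Fin k → Z3)

theorem freqIndex_bijective (k : ℕ) :
    Function.Bijective fun p : Freq k => freqIndex p.1 p.2 := by
  constructor
  · rintro ⟨a, a'⟩ ⟨b, b'⟩ hab
    have h1 : ∀ x, freqIndex a a' x = freqIndex b b' x := congrFun hab
    refine Prod.ext (funext fun i => funext fun c => ?_) (funext fun i => funext fun c => ?_)
    · simpa [freqIndex] using h1 (Sum.inl (i, c))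
    · simpa [freqIndex] using h1 (Sum.inr (i, c))
  · intro n
    refine ⟨(fun i c => n (Sum.inl (i, c)), fun i c => -n (Sum.inr (i, c))), ?_⟩
    funext x
    rcases x with x | x <;> simp [freqIndex]

/-- The Fourier character of frequency `(ξ; ξ')`, as a density matrix. -/
def dmBasis {k : ℕ} (p : Freq k) : DM k := mFourierBasis (freqIndex p.1 p.2)

theorem orthonormal_dmBasis (k : ℕ) : Orthonormal ℂ (dmBasis (k := k)) :=
  (mFourierBasis (d := Coord k)).orthonormal.comp _ (freqIndex_bijective k).1

/-- The Fourier coefficient of frequency `(ξ; ξ')`, as a functional. -/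
def dmCoeff {k : ℕ} (p : Freq k) : DM k →L[ℂ] ℂ := innerSL ℂ (dmBasis p)

theorem dmCoeff_apply {k : ℕ} (p : Freq k) (σ : DM k) : dmCoeff p σ = dmHat σ p.1 p.2 := by
  rw [dmHat, ← mFourierBasis_repr, HilbertBasis.repr_apply_apply]
  rfl

theorem dm_ext {k : ℕ} {σ τ : DM k} (h : ∀ p : Freq k, dmHat σ p.1 p.2 = dmHat τ p.1 p.2) :
    σ = τ := by
  refine (mFourierBasis (d := Coord k)).repr.injective (lp.ext (funext fun n => ?_))
  obtain ⟨p, rfl⟩ := (freqIndex_bijective k).2 n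
  simpa only [dmHat, ← mFourierBasis_repr] using h p

/-- The weight `∏ ⟨ξ_j⟩^α ∏ ⟨ξ'_j⟩^α`. -/
def weight (α : ℝ) {k : ℕ} (p : Freq k) : ℝ :=
  (∏ j, bracket (p.1 j) ^ α) * ∏ j, bracket (p.2 j) ^ α

theorem freqSq_nonneg (ζ : Z3) : 0 ≤ freqSq ζ := Finset.sum_nonneg fun _ _ => sq_nonneg _

theorem one_le_bracket (ζ : Z3) : 1 ≤ bracket ζ := by
  have h : (0 : ℝ) ≤ freqSq ζ := by exact_mod_cast freqSq_nonneg ζ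
  rw [bracket, Real.one_le_sqrt]
  linarith

theorem one_le_weight {α : ℝ} (hα : 0 ≤ α) {k : ℕ} (p : Freq k) : 1 ≤ weight α p := by
  have h (q : Fin k → Z3) : 1 ≤ ∏ j, bracket (q j) ^ α :=
    Finset.one_le_prod fun j _ => Real.one_le_rpow (one_le_bracket _) hα
  exact one_le_mul_of_one_le_of_one_le (h _) (h _)

theorem weight_pos {α : ℝ} {k : ℕ} (p : Freq k) : 0 < weight α p := by
  have h (q : Fin k → Z3) : 0 < ∏ j, bracket (q j) ^ α :=
    Finset.prod_pos fun j _ => Real.rpow_pos_of_pos (one_pos.trans_le (one_le_bracket _)) α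
  exact mul_pos (h _) (h _)

theorem hNorm_sq (α : ℝ) {k : ℕ} (σ : DM k) :
    hNorm α σ ^ (2 : ℝ) = ∑' p : Freq k, ‖(weight α p : ℂ) * dmHat σ p.1 p.2‖ₑ ^ 2 := by
  rw [hNorm, ← ENNReal.rpow_mul, one_div_mul_cancel two_ne_zero, ENNReal.rpow_one]
  exact tsum_congr fun p => ENNReal.rpow_two _

/-! ### Extended norms in sequence and Lebesgue spaces -/

theorem enorm_lpOne {ι : Type*} (x : lp (fun _ : ι => ℂ) 1) : ‖x‖ₑ = ∑' i, ‖x i‖ₑ := by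
  rw [← ofReal_norm, norm_lpOne,
    ENNReal.ofReal_tsum_of_nonneg (fun _ => norm_nonneg _) (summable_norm_lpOne x)]
  simp only [ofReal_norm]

theorem enorm_sq_lpTwo {ι E : Type*} [NormedAddCommGroup E] (x : lp (fun _ : ι => E) 2) :
    ‖x‖ₑ ^ 2 = ∑' i, ‖x i‖ₑ ^ 2 := by
  rw [← ofReal_norm, ← ENNReal.ofReal_pow (norm_nonneg _), norm_sq_lpTwo,
    ENNReal.ofReal_tsum_of_nonneg (fun _ => by positivity) (summable_sq_lpTwo x)]
  simp only [ENNReal.ofReal_pow (norm_nonneg _), ofReal_norm]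

/-- The contraction ℓ¹ → ℓ²: the only inequality between the amplitude norm and the norm of
L²(Ω)H^α. -/
theorem tsum_sq_le_sq_tsum {ι : Type*} (a : ι → ℝ≥0∞) : ∑' i, a i ^ 2 ≤ (∑' i, a i) ^ 2 := by
  rw [sq (∑' i, a i), ← ENNReal.tsum_mul_left]
  refine ENNReal.tsum_le_tsum fun i => ?_
  rw [sq]
  exact mul_le_mul_left (ENNReal.le_tsum i) _

section Random

variable {Ω : Type u} [MeasurableSpace Ω] {P : Measure Ω}

theorem enorm_sq_Lp_two {E : Type*} [NormedAddCommGroup E] (f : Lp E 2 P) :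
    ‖f‖ₑ ^ 2 = ∫⁻ ω, ‖f ω‖ₑ ^ 2 ∂P := by
  rw [Lp.enorm_def, eLpNorm_eq_lintegral_rpow_enorm_toReal (by norm_num) (by norm_num),
    ← ENNReal.rpow_two, ← ENNReal.rpow_mul]
  norm_num

/-- The Fourier coefficient of a random density matrix. -/
def rCoeff {k : ℕ} (p : Freq k) : RDM P k →L[ℂ] Lp ℂ 2 P := (dmCoeff p).compLpL 2 P

theorem coeFn_rCoeff {k : ℕ} (p : Freq k) (σ : RDM P k) :
    rCoeff p σ =ᵐ[P] fun ω => dmHat (σ ω) p.1 p.2 := by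
  filter_upwards [(dmCoeff p).coeFn_compLpL (p := 2) (μ := P) σ] with ω hω
  rw [rCoeff, hω, dmCoeff_apply]

theorem rdm_ext {k : ℕ} {σ τ : RDM P k} (h : ∀ p : Freq k, rCoeff p σ = rCoeff p τ) :
    σ = τ := by
  refine Lp.ext ?_
  have h1 : ∀ᵐ ω ∂P, ∀ p : Freq k, dmHat (σ ω) p.1 p.2 = dmHat (τ ω) p.1 p.2 := by
    refine ae_all_iff.2 fun p => ?_
    filter_upwards [coeFn_rCoeff p σ, coeFn_rCoeff p τ] with ω h2 h3
    rw [← h2, ← h3, h p]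
  filter_upwards [h1] with ω hω
  exact dm_ext hω

theorem rCoeff_freeEvolR {k : ℕ} (p : Freq k) (t : ℝ) (σ : RDM P k) :
    rCoeff p (freeEvolR k t σ) =
      Complex.exp ((-(t * ((∑ j, (freqSq (p.1 j) : ℝ)) - ∑ j, (freqSq (p.2 j) : ℝ))) : ℝ)
        * Complex.I) • rCoeff p σ := by
  refine Lp.ext ?_
  filter_upwards [coeFn_rCoeff p (freeEvolR k t σ), coeFn_rCoeff p σ,
    (freeEvol k t).coeFn_compLpL (p := 2) (μ := P) σ,
    Lp.coeFn_smul (Complex.exp ((-(t * ((∑ j, (freqSq (p.1 j) : ℝ))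
      - ∑ j, (freqSq (p.2 j) : ℝ))) : ℝ) * Complex.I)) (rCoeff p σ)] with ω h1 h2 h3 h4
  rw [h1, h4, Pi.smul_apply, h2, freeEvolR, h3, dmHat_freeEvol, smul_eq_mul]

/-- Tonelli: the norm is read off from the L²(Ω) norms of the individual Fourier coefficients. -/
theorem rNorm_sq (α : ℝ) {k : ℕ} (σ : RDM P k) :
    rNorm α σ ^ (2 : ℝ) = ∑' p : Freq k, ‖(weight α p : ℂ)‖ₑ ^ 2 * ‖rCoeff p σ‖ₑ ^ 2 := by
  rw [rNorm, ← ENNReal.rpow_mul]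
  norm_num
  simp only [← ENNReal.rpow_two, hNorm_sq]
  simp only [ENNReal.rpow_two]
  rw [lintegral_tsum]
  · refine tsum_congr fun p => ?_
    rw [enorm_sq_Lp_two, ← lintegral_const_mul'' _
      ((Lp.aestronglyMeasurable (rCoeff p σ)).enorm.pow_const 2)]
    refine lintegral_congr_ae ?_
    filter_upwards [coeFn_rCoeff p σ] with ω hω
    rw [hω, enorm_mul, mul_pow]
  · intro p
    refine AEMeasurable.pow_const (AEStronglyMeasurable.enorm (AEStronglyMeasurable.const_mul
      ((Lp.aestronglyMeasurable (rCoeff p σ)).congr (coeFn_rCoeff p σ)) _)) 2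

/-! ### Walsh functions -/

variable [IsProbabilityMeasure P] {h : Z3 → Ω → ℝ}

theorem IsBernoulliFamily.ae_sign (hB : IsBernoulliFamily P h) :
    ∀ᵐ ω ∂P, ∀ ζ, h ζ ω = 1 ∨ h ζ ω = -1 := by
  refine ae_all_iff.2 fun ζ => ?_
  have hm (c : ℝ) : MeasurableSet {ω | h ζ ω = c} :=
    hB.measurable ζ (measurableSet_singleton c)
  have hd : Disjoint {ω | h ζ ω = 1} {ω | h ζ ω = -1} := by
    rw [Set.disjoint_left]
    intro ω h1 h2
    rw [Set.mem_ofPred_eq] at h1 h2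
    linarith
  have h1 : P ({ω | h ζ ω = 1} ∪ {ω | h ζ ω = -1}) = 1 := by
    rw [measure_union hd (hm _), hB.prob_one, hB.prob_neg_one, ENNReal.add_halves]
  exact (mem_ae_iff_prob_eq_one ((hm _).union (hm _))).2 h1

/-- The Walsh function `∏_{ζ ∈ A} h_ζ`. -/
def walsh (h : Z3 → Ω → ℝ) (A : Finset Z3) (ω : Ω) : ℝ := ∏ ζ ∈ A, h ζ ω

/-- The product of the signs of all components of a frequency. -/
def freqSign (h : Z3 → Ω → ℝ) {k : ℕ} (p : Freq k) (ω : Ω) : ℝ :=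
  (∏ i, h (p.1 i) ω) * ∏ i, h (p.2 i) ω

theorem sq_eq_one_of_sign {x : ℝ} (hx : x = 1 ∨ x = -1) : x * x = 1 := by
  rcases hx with rfl | rfl <;> norm_num

omit [MeasurableSpace Ω] in
theorem walsh_mul_self {ω : Ω} (hω : ∀ ζ, h ζ ω = 1 ∨ h ζ ω = -1) (A : Finset Z3) :
    walsh h A ω * walsh h A ω = 1 := by
  rw [walsh, ← Finset.prod_mul_distrib]
  exact Finset.prod_eq_one fun ζ _ => sq_eq_one_of_sign (hω ζ)

omit [MeasurableSpace Ω] in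
theorem freqSign_mul_self {ω : Ω} (hω : ∀ ζ, h ζ ω = 1 ∨ h ζ ω = -1) {k : ℕ} (p : Freq k) :
    freqSign h p ω * freqSign h p ω = 1 := by
  rw [freqSign, mul_mul_mul_comm, ← Finset.prod_mul_distrib, ← Finset.prod_mul_distrib,
    Finset.prod_eq_one fun i _ => sq_eq_one_of_sign (hω (p.1 i)),
    Finset.prod_eq_one fun i _ => sq_eq_one_of_sign (hω (p.2 i)), one_mul]

omit [MeasurableSpace Ω] in
-- The signs with index in `A ∩ B` occur twice and square to one.
theorem walsh_mul_walsh {ω : Ω} (hω : ∀ ζ, h ζ ω = 1 ∨ h ζ ω = -1) (A B : Finset Z3) :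
    walsh h A ω * walsh h B ω = walsh h (symmDiff A B) ω := by
  have hd : Disjoint (A \ B) (B \ A) := disjoint_sdiff_sdiff
  have hA : walsh h A ω = walsh h (A ∩ B) ω * walsh h (A \ B) ω :=
    (Finset.prod_inter_mul_prod_sdiff A B _).symm
  have hB : walsh h B ω = walsh h (A ∩ B) ω * walsh h (B \ A) ω := by
    rw [Finset.inter_comm]
    exact (Finset.prod_inter_mul_prod_sdiff B A _).symm
  have hs : walsh h (symmDiff A B) ω = walsh h (A \ B) ω * walsh h (B \ A) ω := by
    rw [symmDiff_def, Finset.sup_eq_union]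
    exact Finset.prod_union hd
  rw [hA, hB, hs, mul_mul_mul_comm, walsh_mul_self hω, one_mul]

omit [IsProbabilityMeasure P] in
theorem measurable_walsh (hB : IsBernoulliFamily P h) (A : Finset Z3) : Measurable (walsh h A) :=
  Finset.measurable_fun_prod A fun ζ _ => hB.measurable ζ

omit [IsProbabilityMeasure P] in
theorem measurable_freqSign (hB : IsBernoulliFamily P h) {k : ℕ} (p : Freq k) :
    Measurable (freqSign h p) :=
  (Finset.measurable_fun_prod _ fun _ _ => hB.measurable _).mul
    (Finset.measurable_fun_prod _ fun _ _ => hB.measurable _)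

theorem integral_sign (hB : IsBernoulliFamily P h) (ζ : Z3) : ∫ ω, h ζ ω ∂P = 0 := by
  have hm (c : ℝ) : MeasurableSet {ω | h ζ ω = c} :=
    hB.measurable ζ (measurableSet_singleton c)
  have hi (c : ℝ) : Integrable ({ω | h ζ ω = c}.indicator fun _ => (1 : ℝ)) P :=
    (integrable_const 1).indicator (hm c)
  have heq : h ζ =ᵐ[P] fun ω => {ω | h ζ ω = 1}.indicator (fun _ => (1 : ℝ)) ω
      - {ω | h ζ ω = -1}.indicator (fun _ => (1 : ℝ)) ω := by
    filter_upwards [hB.ae_sign] with ω hω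
    rcases hω ζ with h1 | h1 <;> simp [Set.indicator, h1] <;> norm_num
  rw [integral_congr_ae heq, integral_sub (hi _) (hi _), integral_indicator_const _ (hm _),
    integral_indicator_const _ (hm _), Measure.real, Measure.real, hB.prob_one, hB.prob_neg_one,
    sub_self]

/-- One sign has mean zero and is independent of the product of the others. -/
theorem integral_walsh (hB : IsBernoulliFamily P h) {A : Finset Z3} (hA : A.Nonempty) :
    ∫ ω, walsh h A ω ∂P = 0 := by
  obtain ⟨ζ, hζ⟩ := hA
  have hind : IndepFun (∏ η ∈ A.erase ζ, h η) (h ζ) P :=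
    hB.indep.indepFun_finsetProd_of_notMem hB.measurable (Finset.notMem_erase ζ A)
  have hw : ∏ η ∈ A.erase ζ, h η = walsh h (A.erase ζ) :=
    funext fun ω => Finset.prod_apply ω _ _
  have h1 := hind.integral_mul_eq_mul_integral
    (hw ▸ (measurable_walsh hB _).aestronglyMeasurable)
    (hB.measurable ζ).aestronglyMeasurable
  rw [integral_sign hB ζ, mul_zero] at h1
  rw [← h1]
  refine integral_congr_ae (Eventually.of_forall fun ω => ?_)
  simp only [walsh, Pi.mul_apply, Finset.prod_apply]
  exact (Finset.prod_erase_mul A _ hζ).symm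

theorem integral_walsh_mul_walsh (hB : IsBernoulliFamily P h) (A B : Finset Z3) :
    ∫ ω, walsh h A ω * walsh h B ω ∂P = if A = B then 1 else 0 := by
  rw [integral_congr_ae (g := walsh h (symmDiff A B))
    (by filter_upwards [hB.ae_sign] with ω hω using walsh_mul_walsh hω A B)]
  split_ifs with hAB
  · subst hAB
    simp [walsh]
  · exact integral_walsh hB (Finset.nonempty_iff_ne_empty.2
      fun hs => hAB (symmDiff_eq_bot.1 hs))

/-- The Walsh function of `A`, multiplied by the sign of a frequency. -/
def twist (h : Z3 → Ω → ℝ) {k : ℕ} (p : Freq k) (A : Finset Z3) (ω : Ω) : ℂ :=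
  ((freqSign h p ω * walsh h A ω : ℝ) : ℂ)

omit [IsProbabilityMeasure P] in
theorem measurable_twist (hB : IsBernoulliFamily P h) {k : ℕ} (p : Freq k) (A : Finset Z3) :
    Measurable (twist h p A) :=
  Complex.measurable_ofReal.comp ((measurable_freqSign hB p).mul (measurable_walsh hB A))

omit [MeasurableSpace Ω] in
theorem norm_twist {ω : Ω} (hω : ∀ ζ, h ζ ω = 1 ∨ h ζ ω = -1) {k : ℕ} (p : Freq k)
    (A : Finset Z3) : ‖twist h p A ω‖ = 1 := by
  rw [twist, Complex.norm_real, Real.norm_eq_abs, abs_mul]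
  have h1 : |freqSign h p ω| = 1 := by
    rw [← sq_eq_sq₀ (abs_nonneg _) zero_le_one, sq_abs, sq, freqSign_mul_self hω, one_pow]
  have h2 : |walsh h A ω| = 1 := by
    rw [← sq_eq_sq₀ (abs_nonneg _) zero_le_one, sq_abs, sq, walsh_mul_self hω, one_pow]
  rw [h1, h2, one_mul]

theorem memLp_twist (hB : IsBernoulliFamily P h) {k : ℕ} (p : Freq k) (A : Finset Z3) :
    MemLp (twist h p A) 2 P :=
  MemLp.of_bound (measurable_twist hB p A).aestronglyMeasurable 1
    (by filter_upwards [hB.ae_sign] with ω hω using (norm_twist hω p A).le)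

/-- The frequency sign is common to both factors and squares away, which leaves the orthonormality
of the Walsh functions. -/
theorem integral_twist (hB : IsBernoulliFamily P h) {k : ℕ} (p : Freq k) (A B : Finset Z3) :
    ∫ ω, starRingEnd ℂ (twist h p A ω) * twist h p B ω ∂P = if A = B then 1 else 0 := by
  have h1 : (fun ω => starRingEnd ℂ (twist h p A ω) * twist h p B ω) =ᵐ[P]
      fun ω => ((walsh h A ω * walsh h B ω : ℝ) : ℂ) := by
    filter_upwards [hB.ae_sign] with ω hω
    simp only [twist, Complex.conj_ofReal, ← Complex.ofReal_mul]
    rw [mul_mul_mul_comm, freqSign_mul_self hω, one_mul]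
  rw [integral_congr_ae h1, integral_complex_ofReal, integral_walsh_mul_walsh hB]
  split_ifs <;> simp

/-- The functions `twist h p A` as elements of `L²(Ω)`. -/
def twistLp (hB : IsBernoulliFamily P h) {k : ℕ} (p : Freq k) (A : Finset Z3) : Lp ℂ 2 P :=
  (memLp_twist hB p A).toLp

theorem orthonormal_twistLp (hB : IsBernoulliFamily P h) {k : ℕ} (p : Freq k) :
    Orthonormal ℂ (twistLp hB p) := by
  rw [orthonormal_iff_ite]
  intro A B
  rw [L2.inner_def, ← integral_twist hB p]
  refine integral_congr_ae ?_
  filter_upwards [(memLp_twist hB p A).coeFn_toLp, (memLp_twist hB p B).coeFn_toLp] with ω h1 h2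
  rw [twistLp, twistLp, h1, h2, RCLike.inner_apply, mul_comm]

/-- The Walsh series with given coefficients, multiplied by the sign of a frequency. -/
def walshSeries (hB : IsBernoulliFamily P h) {k : ℕ} (p : Freq k) :
    lp (fun _ : Finset Z3 => ℂ) 2 →ₗᵢ[ℂ] Lp ℂ 2 P :=
  (orthonormal_twistLp hB p).orthogonalFamily.linearIsometry

theorem hasSum_walshSeries (hB : IsBernoulliFamily P h) {k : ℕ} (p : Freq k)
    (x : lp (fun _ : Finset Z3 => ℂ) 2) :
    HasSum (fun A => x A • twistLp hB p A) (walshSeries hB p x) :=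
  (orthonormal_twistLp hB p).orthogonalFamily.hasSum_linearIsometry x

/-! ### Amplitudes -/

/-- The random density matrix `h_A S(ξ; ξ') e_{(ξ; ξ')}`, where `S` is the product of the signs
of all components of the frequency. -/
def twistDM (hB : IsBernoulliFamily P h) {k : ℕ} (A : Finset Z3) (p : Freq k) : RDM P k :=
  (ContinuousLinearMap.toSpanSingleton ℂ (dmBasis p)).compLpL 2 P (twistLp hB p A)

theorem coeFn_twistDM (hB : IsBernoulliFamily P h) {k : ℕ} (A : Finset Z3) (p : Freq k) :
    twistDM hB A p =ᵐ[P] fun ω => twist h p A ω • dmBasis p := by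
  filter_upwards [(ContinuousLinearMap.toSpanSingleton ℂ (dmBasis p)).coeFn_compLpL
    (p := 2) (μ := P) (twistLp hB p A), (memLp_twist hB p A).coeFn_toLp] with ω h1 h2
  rw [twistDM, h1, ContinuousLinearMap.toSpanSingleton_apply, twistLp, h2]

/-- Different frequencies are already orthogonal for almost every ω; for equal ones the expectation
of the Walsh functions decides. -/
theorem inner_twistDM (hB : IsBernoulliFamily P h) {k : ℕ} (A B : Finset Z3) (p q : Freq k) :
    inner ℂ (twistDM hB A p) (twistDM hB B q) = if p = q then (if A = B then 1 else 0) else 0 := by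
  rw [L2.inner_def]
  have h1 : (fun ω => inner ℂ (twistDM hB A p ω) (twistDM hB B q ω)) =ᵐ[P] fun ω =>
      (if p = q then starRingEnd ℂ (twist h p A ω) * twist h p B ω else 0) := by
    filter_upwards [coeFn_twistDM hB A p, coeFn_twistDM hB B q] with ω h1 h2
    rw [h1, h2, inner_smul_left, inner_smul_right,
      orthonormal_iff_ite.1 (orthonormal_dmBasis k) p q]
    split_ifs with hpq
    · rw [hpq, mul_one]
    · simp
  rw [integral_congr_ae h1]
  split_ifs with hpq hAB
  · rw [integral_twist hB, if_pos hAB]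
  · rw [integral_twist hB, if_neg hAB]
  · simp

theorem rCoeff_twistDM (hB : IsBernoulliFamily P h) {k : ℕ} (A : Finset Z3) (p q : Freq k) :
    rCoeff q (twistDM hB A p) = if p = q then twistLp hB q A else 0 := by
  refine Lp.ext ?_
  filter_upwards [(dmCoeff q).coeFn_compLpL (p := 2) (μ := P) (twistDM hB A p),
    coeFn_twistDM hB A p, (memLp_twist hB q A).coeFn_toLp, Lp.coeFn_zero ℂ 2 P]
    with ω h1 h2 h3 h4
  rw [rCoeff, h1, h2, map_smul, dmCoeff, innerSL_apply_apply,
    orthonormal_iff_ite.1 (orthonormal_dmBasis k) q p]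
  split_ifs with h5 h6 h6
  · rw [twistLp, h3, h5, smul_eq_mul, mul_one]
  · exact absurd h5.symm h6
  · exact absurd h6.symm h5
  · rw [h4, smul_zero, Pi.zero_apply]

theorem orthonormal_twistDM (hB : IsBernoulliFamily P h) {k : ℕ} (A : Finset Z3) :
    Orthonormal ℂ (twistDM hB A : Freq k → RDM P k) := by
  rw [orthonormal_iff_ite]
  intro p q
  rw [inner_twistDM, if_pos rfl]

/-- The random density matrix with Fourier transform `x(ξ; ξ') h_A S(ξ; ξ')`. -/
def twistSeries (hB : IsBernoulliFamily P h) (k : ℕ) (A : Finset Z3) :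
    lp (fun _ : Freq k => ℂ) 2 →ₗᵢ[ℂ] RDM P k :=
  (orthonormal_twistDM hB A).orthogonalFamily.linearIsometry

theorem hasSum_twistSeries (hB : IsBernoulliFamily P h) {k : ℕ} (A : Finset Z3)
    (x : lp (fun _ : Freq k => ℂ) 2) :
    HasSum (fun p => x p • twistDM hB A p) (twistSeries hB k A x) :=
  (orthonormal_twistDM hB A).orthogonalFamily.hasSum_linearIsometry x

theorem rCoeff_twistSeries (hB : IsBernoulliFamily P h) {k : ℕ} (A : Finset Z3) (q : Freq k)
    (x : lp (fun _ : Freq k => ℂ) 2) :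
    rCoeff q (twistSeries hB k A x) = x q • twistLp hB q A := by
  refine ((hasSum_twistSeries hB A x).mapL (rCoeff q)).unique ?_
  convert hasSum_single q (f := fun p => rCoeff q (x p • twistDM hB A p)) ?_ using 1
  · rw [map_smul, rCoeff_twistDM, if_pos rfl]
  · intro p hp
    rw [map_smul, rCoeff_twistDM, if_neg hp, smul_zero]

theorem orthogonalFamily_twistSeries (hB : IsBernoulliFamily P h) (k : ℕ) :
    OrthogonalFamily ℂ (fun _ : Finset Z3 => lp (fun _ : Freq k => ℂ) 2)
      (fun A => twistSeries hB k A) := by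
  intro A B hAB x y
  have h1 (p : Freq k) : inner ℂ (twistDM hB A p) (twistSeries hB k B y) = 0 := by
    refine (((hasSum_twistSeries hB B y).mapL (innerSL ℂ (twistDM hB A p))).unique ?_)
    convert hasSum_zero using 1
    funext q
    rw [map_smul, innerSL_apply_apply, inner_twistDM, if_neg hAB]
    simp
  rw [← inner_conj_symm]
  have h2 : inner ℂ (twistSeries hB k B y) (twistSeries hB k A x) = 0 := by
    refine (((hasSum_twistSeries hB A x).mapL (innerSL ℂ (twistSeries hB k B y))).unique ?_)
    convert hasSum_zero using 1
    funext p
    rw [map_smul, innerSL_apply_apply, ← inner_conj_symm, h1]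
    simp
  rw [h2, map_zero]

/-- Amplitudes of random density matrices of order `k`: an outer sum over Walsh functions, an inner
sum over frequencies. -/
abbrev Amp (k : ℕ) : Type := lp (fun _ : Finset Z3 => lp (fun _ : Freq k => ℂ) 1) 2

/-- The coordinates of a push-forward along `g` with multipliers `m`. The maps `unweight`,
`collapse` and `phaseMul` are all of this type. -/
theorem hasSum_lpOneLift_single {ι κ : Type*} [DecidableEq κ] {r : ℝ≥0∞} [Fact (1 ≤ r)]
    (g : ι → κ) (m : ι → ℂ) {C : ℝ}
    (hφ : ∀ i, ‖(lp.single r (g i) (m i) : lp (fun _ : κ => ℂ) r)‖ ≤ C)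
    (x : lp (fun _ : ι => ℂ) 1) (q : κ) :
    HasSum (fun i => x i * (lp.single r (g i) (m i) : lp (fun _ : κ => ℂ) r) q)
      (lpOneLift (fun i => (lp.single r (g i) (m i) : lp (fun _ : κ => ℂ) r)) C hφ x q) :=
  (hasSum_lpOneLift _ C hφ x).mapL (lp.evalCLM ℂ (fun _ : κ => ℂ) r q)

/-- The embedding `ℓ¹ → ℓ²`, divided by the weight of regularity `α`. -/
def unweight (α : ℝ) (hα : 0 ≤ α) (k : ℕ) :
    lp (fun _ : Freq k => ℂ) 1 →L[ℂ] lp (fun _ : Freq k => ℂ) 2 :=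
  lpOneLift (fun p => lp.single 2 p (((weight α p)⁻¹ : ℝ) : ℂ)) 1 fun p => by
    rw [lp.norm_single (by norm_num), Complex.norm_real, Real.norm_of_nonneg
      (inv_nonneg.2 (weight_pos p).le)]
    exact inv_le_one_of_one_le₀ (one_le_weight hα p)

theorem unweight_apply {α : ℝ} (hα : 0 ≤ α) {k : ℕ} (x : lp (fun _ : Freq k => ℂ) 1)
    (q : Freq k) : unweight α hα k x q = (((weight α q)⁻¹ : ℝ) : ℂ) * x q := by
  refine (hasSum_lpOneLift_single (fun p => p) _ _ x q).unique ?_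
  convert hasSum_single q ?_ using 1
  · rw [lp.single_apply_self, mul_comm]
  · intro p hp
    rw [lp.single_apply_ne _ _ _ hp.symm, mul_zero]

/-- The random density matrix with a given amplitude. -/
def realize (hB : IsBernoulliFamily P h) (α : ℝ) (hα : 0 ≤ α) (k : ℕ) : Amp k →L[ℂ] RDM P k :=
  (orthogonalFamily_twistSeries hB k).linearIsometry.toContinuousLinearMap.comp
    (lpTwoMap (unweight α hα k))

/-- The Walsh coefficients of the Fourier coefficient of frequency `(ξ; ξ')`. -/
def ampCoeff (α : ℝ) {k : ℕ} (q : Freq k) : Amp k →L[ℂ] lp (fun _ : Finset Z3 => ℂ) 2 :=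
  lpTwoMap ((((weight α q)⁻¹ : ℝ) : ℂ) • lp.evalCLM ℂ (fun _ : Freq k => ℂ) 1 q)

theorem ampCoeff_apply (α : ℝ) {k : ℕ} (q : Freq k) (c : Amp k) (A : Finset Z3) :
    ampCoeff α q c A = (((weight α q)⁻¹ : ℝ) : ℂ) * c A q := rfl

/-- Together with `rdm_ext`, this reduces identities for realized density matrices to Walsh series
at one frequency. -/
theorem rCoeff_realize (hB : IsBernoulliFamily P h) {α : ℝ} (hα : 0 ≤ α) {k : ℕ} (q : Freq k)
    (c : Amp k) : rCoeff q (realize hB α hα k c) = walshSeries hB q (ampCoeff α q c) := by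
  refine (((orthogonalFamily_twistSeries hB k).hasSum_linearIsometry _).mapL
    (rCoeff q)).unique ?_
  convert hasSum_walshSeries hB q (ampCoeff α q c) using 2 with A
  refine (rCoeff_twistSeries hB A q _).trans (congrArg (· • twistLp hB q A) ?_)
  exact unweight_apply hα (c A) q

/-- The weights cancel, and orthonormality of the Walsh functions gives the double sum of |c_A(p)|².
Exchanging the sums leaves ℓ² norms in `p`, which are at most the ℓ¹ norms. -/
theorem rNorm_realize_le (hB : IsBernoulliFamily P h) {α : ℝ} (hα : 0 ≤ α) {k : ℕ}
    (c : Amp k) : rNorm α (realize hB α hα k c) ≤ ‖c‖ₑ := by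
  rw [← ENNReal.rpow_le_rpow_iff (z := 2) (by norm_num), rNorm_sq, ENNReal.rpow_two,
    enorm_sq_lpTwo]
  calc ∑' p : Freq k, ‖(weight α p : ℂ)‖ₑ ^ 2 * ‖rCoeff p (realize hB α hα k c)‖ₑ ^ 2
      = ∑' p : Freq k, ∑' A : Finset Z3, ‖c A p‖ₑ ^ 2 := by
        refine tsum_congr fun p => ?_
        have h0 : (weight α p : ℂ) ≠ 0 := Complex.ofReal_ne_zero.2 (weight_pos p).ne'
        rw [rCoeff_realize, LinearIsometry.enorm_map, enorm_sq_lpTwo, ← ENNReal.tsum_mul_left]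
        refine tsum_congr fun A => ?_
        rw [ampCoeff_apply, ← mul_pow, ← enorm_mul, Complex.ofReal_inv, mul_inv_cancel_left₀ h0]
    _ = ∑' A : Finset Z3, ∑' p : Freq k, ‖c A p‖ₑ ^ 2 := ENNReal.tsum_comm
    _ ≤ ∑' A : Finset Z3, ‖c A‖ₑ ^ 2 := by
        refine ENNReal.tsum_le_tsum fun A => ?_
        rw [enorm_lpOne]
        exact tsum_sq_le_sq_tsum _

end Random

/-! ### Collapse maps -/

/-- The constant comes from |a + b - c|² ≤ 3(|a|² + |b|² + |c|²); expanding ∏(1 + |·|²) dominates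
the sum. -/
theorem bracket_add_sub_le (a b c : Z3) :
    bracket (a + b - c) ≤ √3 * (bracket a * bracket b * bracket c) := by
  have ha : (0 : ℝ) ≤ freqSq a := by exact_mod_cast freqSq_nonneg a
  have hb : (0 : ℝ) ≤ freqSq b := by exact_mod_cast freqSq_nonneg b
  have hc : (0 : ℝ) ≤ freqSq c := by exact_mod_cast freqSq_nonneg c
  have h : freqSq (a + b - c) ≤ 3 * (freqSq a + freqSq b + freqSq c) := by
    simp only [freqSq, ← Finset.sum_add_distrib, Finset.mul_sum]
    refine Finset.sum_le_sum fun i _ => ?_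
    simp only [Pi.add_apply, Pi.sub_apply]
    nlinarith [sq_nonneg (a i - b i), sq_nonneg (a i + c i), sq_nonneg (b i + c i)]
  have h' : (freqSq (a + b - c) : ℝ) ≤ 3 * (freqSq a + freqSq b + freqSq c) := by exact_mod_cast h
  rw [bracket, bracket, bracket, bracket, ← Real.sqrt_mul (by positivity),
    ← Real.sqrt_mul (by positivity), ← Real.sqrt_mul (by positivity)]
  refine Real.sqrt_le_sqrt ?_
  nlinarith [mul_nonneg ha hb, mul_nonneg ha hc, mul_nonneg hb hc,
    mul_nonneg (mul_nonneg ha hb) hc]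

/-- The growth factor of the weight of regularity `α` under a collapse. -/
def growth (α : ℝ) : ℝ := √3 ^ α

theorem growth_pos (α : ℝ) : 0 < growth α := Real.rpow_pos_of_pos (by positivity) α

theorem bracket_rpow_add_sub_le {α : ℝ} (hα : 0 ≤ α) (a b c : Z3) :
    bracket (a + b - c) ^ α ≤ growth α * (bracket a ^ α * bracket b ^ α * bracket c ^ α) := by
  have h0 (ζ : Z3) : 0 ≤ bracket ζ := zero_le_one.trans (one_le_bracket ζ)
  rw [growth, ← Real.mul_rpow (h0 a) (h0 b), ← Real.mul_rpow (mul_nonneg (h0 a) (h0 b)) (h0 c),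
    ← Real.mul_rpow (by positivity) (mul_nonneg (mul_nonneg (h0 a) (h0 b)) (h0 c))]
  exact Real.rpow_le_rpow (h0 _) (bracket_add_sub_le a b c) hα

/-- Free of division, so that it serves both the weights and the random signs. -/
theorem prod_update_mul {k : ℕ} (f : Z3 → ℝ) (u : Fin k → Z3) (j : Fin k) (v : Z3) :
    (∏ i, f (Function.update u j v i)) * f (u j) = f v * ∏ i, f (u i) := by
  rw [← Finset.mul_prod_erase Finset.univ (fun i => f (Function.update u j v i))
      (Finset.mem_univ j),
    ← Finset.mul_prod_erase Finset.univ (fun i => f (u i)) (Finset.mem_univ j),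
    Function.update_self,
    Finset.prod_congr rfl fun i hi => by rw [Function.update_of_ne (Finset.ne_of_mem_erase hi)]]
  ring

/-- The output frequency of `B_{j,k+1}^+` for a given input frequency. -/
def plusMap {k : ℕ} (j : Fin k) (η : Freq (k + 1)) : Freq k :=
  (Function.update (fun i => η.1 i.castSucc) j
    (η.1 j.castSucc + η.1 (Fin.last k) - η.2 (Fin.last k)), fun i => η.2 i.castSucc)

/-- The output frequency of `B_{j,k+1}^-` for a given input frequency. -/
def minusMap {k : ℕ} (j : Fin k) (η : Freq (k + 1)) : Freq k :=
  (fun i => η.1 i.castSucc, Function.update (fun i => η.2 i.castSucc) j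
    (η.2 j.castSucc + η.2 (Fin.last k) - η.1 (Fin.last k)))

/-- The input frequencies of `B_{j,k+1}^+` for a given output frequency. -/
def plusInput {k : ℕ} (j : Fin k) (p : Freq k) (q : Z3 × Z3) : Freq (k + 1) :=
  (Fin.snoc (α := fun _ => Z3) (Function.update p.1 j (p.1 j - q.1 + q.2)) q.1,
    Fin.snoc (α := fun _ => Z3) p.2 q.2)

/-- The input frequencies of `B_{j,k+1}^-` for a given output frequency. -/
def minusInput {k : ℕ} (j : Fin k) (p : Freq k) (q : Z3 × Z3) : Freq (k + 1) :=
  (Fin.snoc (α := fun _ => Z3) p.1 q.1,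
    Fin.snoc (α := fun _ => Z3) (Function.update p.2 j (p.2 j - q.2 + q.1)) q.2)

theorem plusInput_injective {k : ℕ} (j : Fin k) (p : Freq k) :
    Function.Injective (plusInput j p) := by
  intro q r hqr
  have h1 := congrFun (congrArg Prod.fst hqr) (Fin.last k)
  have h2 := congrFun (congrArg Prod.snd hqr) (Fin.last k)
  simp only [plusInput, Fin.snoc_last] at h1 h2
  exact Prod.ext h1 h2

theorem minusInput_injective {k : ℕ} (j : Fin k) (p : Freq k) :
    Function.Injective (minusInput j p) := by
  intro q r hqr
  have h1 := congrFun (congrArg Prod.fst hqr) (Fin.last k)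
  have h2 := congrFun (congrArg Prod.snd hqr) (Fin.last k)
  simp only [minusInput, Fin.snoc_last] at h1 h2
  exact Prod.ext h1 h2

/-- The fibre of the collapse over `p` is parametrized by (μ, μ'); this turns a push-forward into
the collision series. -/
theorem plusMap_eq_iff {k : ℕ} (j : Fin k) (p : Freq k) (η : Freq (k + 1)) :
    plusMap j η = p ↔ η ∈ Set.range (plusInput j p) := by
  constructor
  · rintro rfl
    refine ⟨(η.1 (Fin.last k), η.2 (Fin.last k)), Prod.ext (funext fun i => ?_)
      (funext fun i => ?_)⟩
    · refine Fin.lastCases ?_ (fun i => ?_) i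
      · simp only [plusInput, Fin.snoc_last]
      · by_cases hij : i = j
        · subst hij
          simp only [plusInput, plusMap, Fin.snoc_castSucc, Function.update_self]
          abel
        · simp only [plusInput, plusMap, Fin.snoc_castSucc, Function.update_of_ne hij]
    · refine Fin.lastCases ?_ (fun i => ?_) i <;>
        simp only [plusInput, plusMap, Fin.snoc_castSucc, Fin.snoc_last]
  · rintro ⟨q, rfl⟩
    refine Prod.ext (funext fun i => ?_) (funext fun i => ?_)
    · by_cases hij : i = j
      · subst hij
        simp only [plusInput, plusMap, Fin.snoc_castSucc, Fin.snoc_last, Function.update_self]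
        abel
      · simp only [plusInput, plusMap, Fin.snoc_castSucc, Function.update_of_ne hij]
    · simp only [plusInput, plusMap, Fin.snoc_castSucc]

theorem minusMap_eq_iff {k : ℕ} (j : Fin k) (p : Freq k) (η : Freq (k + 1)) :
    minusMap j η = p ↔ η ∈ Set.range (minusInput j p) := by
  constructor
  · rintro rfl
    refine ⟨(η.1 (Fin.last k), η.2 (Fin.last k)), Prod.ext (funext fun i => ?_)
      (funext fun i => ?_)⟩
    · refine Fin.lastCases ?_ (fun i => ?_) i <;>
        simp only [minusInput, minusMap, Fin.snoc_castSucc, Fin.snoc_last]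
    · refine Fin.lastCases ?_ (fun i => ?_) i
      · simp only [minusInput, Fin.snoc_last]
      · by_cases hij : i = j
        · subst hij
          simp only [minusInput, minusMap, Fin.snoc_castSucc, Function.update_self]
          abel
        · simp only [minusInput, minusMap, Fin.snoc_castSucc, Function.update_of_ne hij]
  · rintro ⟨q, rfl⟩
    refine Prod.ext (funext fun i => ?_) (funext fun i => ?_)
    · simp only [minusInput, minusMap, Fin.snoc_castSucc]
    · by_cases hij : i = j
      · subst hij
        simp only [minusInput, minusMap, Fin.snoc_castSucc, Fin.snoc_last, Function.update_self]
        abel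
      · simp only [minusInput, minusMap, Fin.snoc_castSucc, Function.update_of_ne hij]

theorem prod_update_le {k : ℕ} {f : Z3 → ℝ} (hf : ∀ ζ, 0 < f ζ) {u : Fin k → Z3} {j : Fin k}
    {v : Z3} {c b b' : ℝ} (hv : f v ≤ c * (f (u j) * b * b')) :
    ∏ i, f (Function.update u j v i) ≤ c * ((∏ i, f (u i)) * b * b') := by
  refine le_of_mul_le_mul_right ?_ (hf (u j))
  rw [prod_update_mul]
  have := mul_le_mul_of_nonneg_right hv (Finset.prod_pos fun i _ => hf (u i)).le
    (b := f v) (a := ∏ i, f (u i))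
  linarith

theorem weight_plusMap_le {α : ℝ} (hα : 0 ≤ α) {k : ℕ} (j : Fin k) (η : Freq (k + 1)) :
    weight α (plusMap j η) ≤ growth α * weight α η := by
  have hf (ζ : Z3) : 0 < bracket ζ ^ α :=
    Real.rpow_pos_of_pos (one_pos.trans_le (one_le_bracket _)) α
  have h1 := prod_update_le (u := fun i => η.1 i.castSucc) (j := j) hf
    (bracket_rpow_add_sub_le hα (η.1 j.castSucc) (η.1 (Fin.last k)) (η.2 (Fin.last k)))
  have h2 := mul_le_mul_of_nonneg_right h1
    (Finset.prod_pos fun i (_ : i ∈ Finset.univ) => hf (η.2 (Fin.castSucc i))).le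
  refine h2.trans_eq ?_
  rw [weight, Fin.prod_univ_castSucc, Fin.prod_univ_castSucc]
  ring

theorem weight_minusMap_le {α : ℝ} (hα : 0 ≤ α) {k : ℕ} (j : Fin k) (η : Freq (k + 1)) :
    weight α (minusMap j η) ≤ growth α * weight α η := by
  have hf (ζ : Z3) : 0 < bracket ζ ^ α :=
    Real.rpow_pos_of_pos (one_pos.trans_le (one_le_bracket _)) α
  have h1 := prod_update_le (u := fun i => η.2 i.castSucc) (j := j) hf
    (bracket_rpow_add_sub_le hα (η.2 j.castSucc) (η.2 (Fin.last k)) (η.1 (Fin.last k)))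
  have h2 := mul_le_mul_of_nonneg_left h1
    (Finset.prod_pos fun i (_ : i ∈ Finset.univ) => hf (η.1 (Fin.castSucc i))).le
  refine h2.trans_eq ?_
  rw [weight, Fin.prod_univ_castSucc, Fin.prod_univ_castSucc]
  ring

theorem norm_collapse_single_le {α : ℝ} {k : ℕ} {g : Freq (k + 1) → Freq k}
    (hg : ∀ η, weight α (g η) ≤ growth α * weight α η) (η : Freq (k + 1)) :
    ‖(lp.single 1 (g η) ((weight α (g η) / weight α η : ℝ) : ℂ) :
      lp (fun _ : Freq k => ℂ) 1)‖ ≤ growth α := by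
  rw [lp.norm_single (by norm_num), Complex.norm_real, Real.norm_of_nonneg
    (div_nonneg (weight_pos _).le (weight_pos _).le), div_le_iff₀ (weight_pos _)]
  exact hg η

/-- The push-forward of Fourier coefficients under a map of frequencies, in terms of the weighted
coefficients. -/
def collapse (α : ℝ) {k : ℕ} (g : Freq (k + 1) → Freq k)
    (hg : ∀ η, weight α (g η) ≤ growth α * weight α η) :
    lp (fun _ : Freq (k + 1) => ℂ) 1 →L[ℂ] lp (fun _ : Freq k => ℂ) 1 :=
  lpOneLift (fun η => lp.single 1 (g η) ((weight α (g η) / weight α η : ℝ) : ℂ)) (growth α)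
    (norm_collapse_single_le hg)

theorem norm_collapse_le (α : ℝ) {k : ℕ} (g : Freq (k + 1) → Freq k)
    (hg : ∀ η, weight α (g η) ≤ growth α * weight α η) : ‖collapse α g hg‖ ≤ growth α :=
  norm_lpOneLift_le _ (growth_pos α).le _

theorem hasSum_collapse {α : ℝ} {k : ℕ} {g : Freq (k + 1) → Freq k}
    (hg : ∀ η, weight α (g η) ≤ growth α * weight α η) {p : Freq k} {e : Z3 × Z3 → Freq (k + 1)}
    (he : Function.Injective e) (hge : ∀ η, g η = p ↔ η ∈ Set.range e)
    (x : lp (fun _ : Freq (k + 1) => ℂ) 1) :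
    HasSum (fun q => (((weight α (e q))⁻¹ : ℝ) : ℂ) * x (e q))
      ((((weight α p)⁻¹ : ℝ) : ℂ) * collapse α g hg x p) := by
  have h1 := (hasSum_lpOneLift_single (r := 1) g (fun η => ((weight α (g η) / weight α η : ℝ) : ℂ))
    (C := growth α) (norm_collapse_single_le hg) x p).mul_left (((weight α p)⁻¹ : ℝ) : ℂ)
  rw [← he.hasSum_iff] at h1
  · refine h1.congr_fun fun q => ?_
    have h0 : (weight α p : ℂ) ≠ 0 := Complex.ofReal_ne_zero.2 (weight_pos p).ne'
    have h2 : g (e q) = p := (hge _).2 ⟨q, rfl⟩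
    simp only [Function.comp_apply, h2, lp.single_apply_self]
    push_cast
    field_simp
  · intro η hη
    have h2 : p ≠ g η := fun h3 => hη ((hge η).1 h3.symm)
    rw [lp.single_apply_ne _ _ _ h2, mul_zero, mul_zero]

/-- The partial sums act on each c_A as functionals on ℓ¹. They have norm at most 1, since `e` is
injective and the weights are at least 1, and they converge pointwise by `hasSum_collapse`. Strong
convergence then passes to the ℓ²-sum over A. -/
theorem hasSum_ampCoeff_collapse {α : ℝ} (hα : 0 ≤ α) {k : ℕ} {g : Freq (k + 1) → Freq k}
    (hg : ∀ η, weight α (g η) ≤ growth α * weight α η) {p : Freq k} {e : Z3 × Z3 → Freq (k + 1)}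
    (he : Function.Injective e) (hge : ∀ η, g η = p ↔ η ∈ Set.range e) (c : Amp (k + 1)) :
    HasSum (fun q => ampCoeff α (e q) c) (ampCoeff α p (lpTwoMap (collapse α g hg) c)) := by
  let S (q : Z3 × Z3) : lp (fun _ : Freq (k + 1) => ℂ) 1 →L[ℂ] ℂ :=
    (((weight α (e q))⁻¹ : ℝ) : ℂ) • lp.evalCLM ℂ (fun _ : Freq (k + 1) => ℂ) 1 (e q)
  let T₀ : lp (fun _ : Freq (k + 1) => ℂ) 1 →L[ℂ] ℂ :=
    ((((weight α p)⁻¹ : ℝ) : ℂ) • lp.evalCLM ℂ (fun _ : Freq k => ℂ) 1 p).comp (collapse α g hg)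
  -- The maximum provides one constant for the partial sums and for their limit.
  have hS (Q : Finset (Z3 × Z3)) : ‖∑ q ∈ Q, S q‖ ≤ max 1 ‖T₀‖ := by
    refine ContinuousLinearMap.opNorm_le_bound _ (by positivity) fun x => ?_
    rw [sum_apply]
    calc ‖∑ q ∈ Q, S q x‖ ≤ ∑ q ∈ Q, ‖x (e q)‖ := by
          refine (norm_sum_le _ _).trans (Finset.sum_le_sum fun q _ => ?_)
          change ‖(((weight α (e q))⁻¹ : ℝ) : ℂ) * x (e q)‖ ≤ _
          rw [norm_mul, Complex.norm_real, Real.norm_of_nonneg (inv_nonneg.2 (weight_pos _).le)]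
          exact mul_le_of_le_one_left (norm_nonneg _)
            (inv_le_one_of_one_le₀ (one_le_weight hα _))
      _ = ∑ η ∈ Q.map ⟨e, he⟩, ‖x η‖ := by rw [Finset.sum_map]; rfl
      _ ≤ ‖x‖ := by
          rw [norm_lpOne]
          exact (summable_norm_lpOne x).sum_le_tsum _ fun _ _ => norm_nonneg _
      _ ≤ max 1 ‖T₀‖ * ‖x‖ := le_mul_of_one_le_left (norm_nonneg _) (le_max_left _ _)
  have hlim := tendsto_lpTwoMap (l := atTop) hS (le_max_right 1 ‖T₀‖) (fun x => by
    simp only [sum_apply]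
    exact hasSum_collapse hg he hge x) c
  refine Tendsto.congr (fun Q => ?_) hlim
  refine lp.ext (funext fun A => ?_)
  rw [lp.coeFn_sum, Finset.sum_apply, lpTwoMap_apply, sum_apply]
  rfl

section Random

variable {Ω : Type u} [MeasurableSpace Ω] {P : Measure Ω} [IsProbabilityMeasure P]
  {h : Z3 → Ω → ℝ}

/-! ### The collision operator on amplitudes -/

omit [IsProbabilityMeasure P] in
theorem hasSumL2_of_hasSum {F : Z3 × Z3 → Ω → ℂ} {S : Ω → ℂ} {f : Z3 × Z3 → Lp ℂ 2 P}
    {s : Lp ℂ 2 P} (hF : ∀ q, F q =ᵐ[P] f q) (hS : S =ᵐ[P] s) (hf : HasSum f s) :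
    HasSumL2 P F S := by
  have h1 : Tendsto (fun Q : Finset (Z3 × Z3) => ‖∑ q ∈ Q, f q - s‖ₑ) atTop (𝓝 0) := by
    have h2 := ((show Tendsto (fun Q => ∑ q ∈ Q, f q) atTop (𝓝 s) from hf).sub_const s).enorm
    simpa using h2
  refine h1.congr fun Q => ?_
  rw [Lp.enorm_def]
  refine eLpNorm_congr_ae ?_
  filter_upwards [Lp.coeFn_sub (∑ q ∈ Q, f q) s, hS, ae_all_iff.2 hF,
    Lp.coeFn_finsetSum Q f] with ω h2 h3 h4 h5
  rw [h2, Pi.sub_apply, h5, Finset.sum_apply, h3]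
  simp only [h4]

/-- Multiplication by `s`, of modulus one almost surely, is continuous on L²(Ω). It exchanges the
sign of `r` for that of `p` in every Walsh term, so the coefficients `x` are unchanged. -/
theorem sign_mul_walshSeries (hB : IsBernoulliFamily P h) {k l : ℕ} {p : Freq k} {r : Freq l}
    {s : Ω → ℝ} (hs : Measurable s)
    (hsign : ∀ ω, (∀ ζ, h ζ ω = 1 ∨ h ζ ω = -1) → s ω * freqSign h r ω = freqSign h p ω)
    (x : lp (fun _ : Finset Z3 => ℂ) 2) :
    (fun ω => (s ω : ℂ) * walshSeries hB r x ω) =ᵐ[P] walshSeries hB p x := by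
  have hs1 : MemLp (fun ω => (s ω : ℂ)) ∞ P := by
    refine memLp_top_of_bound (Complex.measurable_ofReal.comp hs).aestronglyMeasurable 1 ?_
    filter_upwards [hB.ae_sign] with ω hω
    have h1 : s ω = freqSign h p ω * freqSign h r ω := by
      rw [← hsign ω hω, mul_assoc, freqSign_mul_self hω, mul_one]
    have h2 : s ω ^ 2 = 1 := by
      rw [h1, mul_pow, sq, sq, freqSign_mul_self hω, freqSign_mul_self hω, one_mul]
    rw [Complex.norm_real, Real.norm_eq_abs, ← sq_le_sq₀ (abs_nonneg _) zero_le_one, sq_abs, h2,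
      one_pow]
  let M : Lp ℂ 2 P →L[ℂ] Lp ℂ 2 P :=
    (ContinuousLinearMap.mul ℂ ℂ).holderL P ∞ 2 2 hs1.toLp
  have hM (f : Lp ℂ 2 P) : M f =ᵐ[P] fun ω => (s ω : ℂ) * f ω := by
    filter_upwards [(ContinuousLinearMap.mul ℂ ℂ).coeFn_holder (r := 2) hs1.toLp f,
      hs1.coeFn_toLp] with ω h1 h2
    rw [← h2]
    exact h1
  have hbasis (A : Finset Z3) : M (twistLp hB r A) = twistLp hB p A := by
    refine Lp.ext ?_
    filter_upwards [hM (twistLp hB r A), (memLp_twist hB r A).coeFn_toLp,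
      (memLp_twist hB p A).coeFn_toLp, hB.ae_sign] with ω h1 h2 h3 h4
    rw [h1, twistLp, twistLp, h2, h3, twist, twist, ← Complex.ofReal_mul, ← mul_assoc,
      hsign ω h4]
  have heq : M (walshSeries hB r x) = walshSeries hB p x := by
    refine ((hasSum_walshSeries hB r x).mapL M).unique ?_
    simp only [map_smul, hbasis]
    exact hasSum_walshSeries hB p x
  rw [← heq]
  exact (hM _).symm

theorem hasSumL2_realize_collapse (hB : IsBernoulliFamily P h) {α : ℝ} (hα : 0 ≤ α) {k : ℕ}
    {g : Freq (k + 1) → Freq k} (hg : ∀ η, weight α (g η) ≤ growth α * weight α η) {p : Freq k}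
    {e : Z3 × Z3 → Freq (k + 1)} (he : Function.Injective e)
    (hge : ∀ η, g η = p ↔ η ∈ Set.range e) {s : Z3 × Z3 → Ω → ℝ} (hs : ∀ q, Measurable (s q))
    (hsign : ∀ q ω, (∀ ζ, h ζ ω = 1 ∨ h ζ ω = -1) →
      s q ω * freqSign h (e q) ω = freqSign h p ω) (c : Amp (k + 1)) :
    HasSumL2 P (fun q ω => (s q ω : ℂ) * dmHat (realize hB α hα (k + 1) c ω) (e q).1 (e q).2)
      (fun ω => dmHat (realize hB α hα k (lpTwoMap (collapse α g hg) c) ω) p.1 p.2) := by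
  refine hasSumL2_of_hasSum (f := fun q => walshSeries hB p (ampCoeff α (e q) c))
    (s := walshSeries hB p (ampCoeff α p (lpTwoMap (collapse α g hg) c))) (fun q => ?_) ?_
    ((hasSum_ampCoeff_collapse hα hg he hge c).mapL
      (walshSeries hB p).toContinuousLinearMap)
  · filter_upwards [coeFn_rCoeff (e q) (realize hB α hα (k + 1) c),
      sign_mul_walshSeries hB (hs q) (hsign q) (ampCoeff α (e q) c)] with ω h1 h2
    rw [← h1, rCoeff_realize]
    exact h2
  · rw [← rCoeff_realize hB hα]
    exact (coeFn_rCoeff p _).symm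

theorem isCollisionPlus_realize (hB : IsBernoulliFamily P h) {α : ℝ} (hα : 0 ≤ α) {k : ℕ}
    (j : Fin k) (c : Amp (k + 1)) :
    IsCollisionPlus h j (realize hB α hα (k + 1) c)
      (realize hB α hα k (lpTwoMap (collapse α (plusMap j) (weight_plusMap_le hα j)) c)) := by
  intro ξ ξ'
  refine hasSumL2_realize_collapse hB hα (weight_plusMap_le hα j)
    (plusInput_injective j (ξ, ξ')) (plusMap_eq_iff j (ξ, ξ'))
    (s := fun q ω => h (ξ j) ω * h (ξ j - q.1 + q.2) ω * h q.1 ω * h q.2 ω) (fun q => ?_)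
    (fun q ω hω => ?_) c
  · exact (((hB.measurable _).mul (hB.measurable _)).mul (hB.measurable _)).mul (hB.measurable _)
  · simp only [freqSign, plusInput, Fin.prod_univ_castSucc, Fin.snoc_castSucc, Fin.snoc_last]
    have h1 := prod_update_mul (fun ζ => h ζ ω) ξ j (ξ j - q.1 + q.2)
    have h2 := sq_eq_one_of_sign (hω (ξ j - q.1 + q.2))
    have h3 := sq_eq_one_of_sign (hω q.1)
    have h4 := sq_eq_one_of_sign (hω q.2)
    -- `h1` trades the sign of `ξ j` for that of the component replacing it; `h2`, `h3`, `h4` remove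
    -- the squares of the three signs that then occur twice.
    linear_combination (h (ξ j - q.1 + q.2) ω * (h q.1 ω * h q.1 ω) * (h q.2 ω * h q.2 ω)
        * ∏ i, h (ξ' i) ω) * h1
      + ((h q.1 ω * h q.1 ω) * (h q.2 ω * h q.2 ω) * (∏ i, h (ξ i) ω) * ∏ i, h (ξ' i) ω) * h2
      + ((h q.2 ω * h q.2 ω) * (∏ i, h (ξ i) ω) * ∏ i, h (ξ' i) ω) * h3
      + ((∏ i, h (ξ i) ω) * ∏ i, h (ξ' i) ω) * h4

theorem isCollisionMinus_realize (hB : IsBernoulliFamily P h) {α : ℝ} (hα : 0 ≤ α) {k : ℕ}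
    (j : Fin k) (c : Amp (k + 1)) :
    IsCollisionMinus h j (realize hB α hα (k + 1) c)
      (realize hB α hα k (lpTwoMap (collapse α (minusMap j) (weight_minusMap_le hα j)) c)) := by
  intro ξ ξ'
  refine hasSumL2_realize_collapse hB hα (weight_minusMap_le hα j)
    (minusInput_injective j (ξ, ξ')) (minusMap_eq_iff j (ξ, ξ'))
    (s := fun q ω => h (ξ' j) ω * h (ξ' j - q.2 + q.1) ω * h q.1 ω * h q.2 ω) (fun q => ?_)
    (fun q ω hω => ?_) c
  · exact (((hB.measurable _).mul (hB.measurable _)).mul (hB.measurable _)).mul (hB.measurable _)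
  · simp only [freqSign, minusInput, Fin.prod_univ_castSucc, Fin.snoc_castSucc, Fin.snoc_last]
    have h1 := prod_update_mul (fun ζ => h ζ ω) ξ' j (ξ' j - q.2 + q.1)
    have h2 := sq_eq_one_of_sign (hω (ξ' j - q.2 + q.1))
    have h3 := sq_eq_one_of_sign (hω q.1)
    have h4 := sq_eq_one_of_sign (hω q.2)
    linear_combination (h (ξ' j - q.2 + q.1) ω * (h q.1 ω * h q.1 ω) * (h q.2 ω * h q.2 ω)
        * ∏ i, h (ξ i) ω) * h1
      + ((h q.1 ω * h q.1 ω) * (h q.2 ω * h q.2 ω) * (∏ i, h (ξ i) ω) * ∏ i, h (ξ' i) ω) * h2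
      + ((h q.2 ω * h q.2 ω) * (∏ i, h (ξ i) ω) * ∏ i, h (ξ' i) ω) * h3
      + ((∏ i, h (ξ i) ω) * ∏ i, h (ξ' i) ω) * h4

/-- The collision operator on amplitudes. -/
def ampCollision (α : ℝ) (hα : 0 ≤ α) (k : ℕ) : Amp (k + 1) →L[ℂ] Amp k :=
  ∑ j : Fin k, (lpTwoMap (collapse α (plusMap j) (weight_plusMap_le hα j))
    - lpTwoMap (collapse α (minusMap j) (weight_minusMap_le hα j)))

theorem norm_ampCollision_le {α : ℝ} (hα : 0 ≤ α) (k : ℕ) :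
    ‖ampCollision α hα k‖ ≤ 2 * growth α * k := by
  refine (norm_sum_le _ _).trans ?_
  calc _ ≤ ∑ _ : Fin k, 2 * growth α := Finset.sum_le_sum fun j _ => by
        refine (norm_sub_le _ _).trans ?_
        rw [two_mul]
        exact add_le_add ((norm_lpTwoMap_le _).trans (norm_collapse_le _ _ _))
          ((norm_lpTwoMap_le _).trans (norm_collapse_le _ _ _))
    _ = 2 * growth α * k := by simp [mul_comm]

theorem isCollision_realize (hB : IsBernoulliFamily P h) {α : ℝ} (hα : 0 ≤ α) {k : ℕ}
    (c : Amp (k + 1)) :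
    IsCollision h (realize hB α hα (k + 1) c) (realize hB α hα k (ampCollision α hα k c)) := by
  refine ⟨_, _, fun j => isCollisionPlus_realize hB hα j c,
    fun j => isCollisionMinus_realize hB hα j c, ?_⟩
  simp only [ampCollision, sum_apply, sub_apply, map_sum,
    map_sub]

/-! ### Uniqueness of the value of the collision operator -/

omit [IsProbabilityMeasure P] in
theorem HasSumL2.unique {F : Z3 × Z3 → Ω → ℂ} {S S' : Ω → ℂ}
    (hF : ∀ q, AEStronglyMeasurable (F q) P) (hS : AEStronglyMeasurable S P)
    (hS' : AEStronglyMeasurable S' P) (h1 : HasSumL2 P F S) (h2 : HasSumL2 P F S') :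
    S =ᵐ[P] S' := by
  have h3 : Tendsto (fun _ : Finset (Z3 × Z3) => eLpNorm (S' - S) 2 P) atTop (𝓝 0) := by
    have h4 : Tendsto (fun Q : Finset (Z3 × Z3) => eLpNorm (fun ω => (∑ q ∈ Q, F q ω) - S ω) 2 P
        + eLpNorm (fun ω => (∑ q ∈ Q, F q ω) - S' ω) 2 P) atTop (𝓝 0) := by
      simpa using h1.add h2
    refine tendsto_of_tendsto_of_tendsto_of_le_of_le tendsto_const_nhds h4 (fun _ => zero_le)
      fun Q => ?_
    have hm : AEStronglyMeasurable (fun ω => ∑ q ∈ Q, F q ω) P :=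
      Finset.aestronglyMeasurable_fun_sum Q fun q _ => hF q
    have h5 : S' - S = (fun ω => (∑ q ∈ Q, F q ω) - S ω) - fun ω => (∑ q ∈ Q, F q ω) - S' ω := by
      funext ω
      simp
    rw [h5]
    exact eLpNorm_sub_le (hm.sub hS) (hm.sub hS') (by norm_num)
  have h6 : eLpNorm (S' - S) 2 P = 0 := tendsto_nhds_unique tendsto_const_nhds h3
  rw [eLpNorm_eq_zero_iff (hS'.sub hS) (by norm_num)] at h6
  filter_upwards [h6] with ω hω
  exact (sub_eq_zero.1 hω).symm

omit [IsProbabilityMeasure P] in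
theorem aestronglyMeasurable_dmHat {k : ℕ} (σ : RDM P k) (ξ ξ' : Fin k → Z3) :
    AEStronglyMeasurable (fun ω => dmHat (σ ω) ξ ξ') P :=
  (Lp.aestronglyMeasurable (rCoeff (ξ, ξ') σ)).congr (coeFn_rCoeff (ξ, ξ') σ)

omit [IsProbabilityMeasure P] in
theorem rdm_ext_of_ae {k : ℕ} {σ τ : RDM P k}
    (hστ : ∀ ξ ξ', (fun ω => dmHat (σ ω) ξ ξ') =ᵐ[P] fun ω => dmHat (τ ω) ξ ξ') : σ = τ :=
  rdm_ext fun p => Lp.ext (((coeFn_rCoeff p σ).trans (hστ p.1 p.2)).trans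
    (coeFn_rCoeff p τ).symm)

omit [IsProbabilityMeasure P] in
-- L²(Ω) limits of the series fix all Fourier coefficients. This is needed because `collision` is
-- defined by choice.
theorem IsCollision.unique (hB : IsBernoulliFamily P h) {k : ℕ} {σ : RDM P (k + 1)}
    {τ τ' : RDM P k} (h1 : IsCollision h σ τ) (h2 : IsCollision h σ τ') : τ = τ' := by
  obtain ⟨τp, τm, hp, hm, rfl⟩ := h1
  obtain ⟨τp', τm', hp', hm', rfl⟩ := h2
  have hmeas (a b c d : Z3) (ξ ξ' : Fin (k + 1) → Z3) : AEStronglyMeasurable (fun ω =>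
      ((h a ω * h b ω * h c ω * h d ω : ℝ) : ℂ) * dmHat (σ ω) ξ ξ') P :=
    (Complex.measurable_ofReal.comp ((((hB.measurable a).mul (hB.measurable b)).mul
      (hB.measurable c)).mul (hB.measurable d))).aestronglyMeasurable.mul
      (aestronglyMeasurable_dmHat σ ξ ξ')
  refine Finset.sum_congr rfl fun j _ => ?_
  have h3 : τp j = τp' j := rdm_ext_of_ae fun ξ ξ' => HasSumL2.unique (fun q => hmeas _ _ _ _ _ _)
    (aestronglyMeasurable_dmHat _ _ _) (aestronglyMeasurable_dmHat _ _ _)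
    (hp j ξ ξ') (hp' j ξ ξ')
  have h4 : τm j = τm' j := rdm_ext_of_ae fun ξ ξ' => HasSumL2.unique (fun q => hmeas _ _ _ _ _ _)
    (aestronglyMeasurable_dmHat _ _ _) (aestronglyMeasurable_dmHat _ _ _)
    (hm j ξ ξ') (hm' j ξ ξ')
  rw [h3, h4]

theorem collisionDefined_realize (hB : IsBernoulliFamily P h) {α : ℝ} (hα : 0 ≤ α) {k : ℕ}
    (c : Amp (k + 1)) : CollisionDefined h (realize hB α hα (k + 1) c) :=
  ⟨_, isCollision_realize hB hα c⟩

theorem collision_realize (hB : IsBernoulliFamily P h) {α : ℝ} (hα : 0 ≤ α) {k : ℕ}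
    (c : Amp (k + 1)) :
    collision h k (realize hB α hα (k + 1) c) = realize hB α hα k (ampCollision α hα k c) := by
  rw [collision, dif_pos (collisionDefined_realize hB hα c)]
  exact (Classical.choose_spec (collisionDefined_realize hB hα c)).unique hB
    (isCollision_realize hB hα c)

/-! ### The free evolution on amplitudes -/

/-- The phase factor of the free evolution. -/
def phase (t : ℝ) {k : ℕ} (p : Freq k) : ℂ :=
  Complex.exp ((-(t * ((∑ j, (freqSq (p.1 j) : ℝ)) - ∑ j, (freqSq (p.2 j) : ℝ))) : ℝ)
    * Complex.I)

/-- The free evolution of weighted Fourier coefficients. -/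
def phaseMul (t : ℝ) (k : ℕ) :
    lp (fun _ : Freq k => ℂ) 1 →L[ℂ] lp (fun _ : Freq k => ℂ) 1 :=
  lpOneLift (fun p => lp.single 1 p (phase t p)) 1 fun p => by
    rw [lp.norm_single (by norm_num), phase, Complex.norm_exp_ofReal_mul_I]

theorem phaseMul_apply (t : ℝ) {k : ℕ} (x : lp (fun _ : Freq k => ℂ) 1) (q : Freq k) :
    phaseMul t k x q = phase t q * x q := by
  refine (hasSum_lpOneLift_single (fun p => p) _ _ x q).unique ?_
  convert hasSum_single q ?_ using 1
  · rw [lp.single_apply_self, mul_comm]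
  · intro p hp
    rw [lp.single_apply_ne _ _ _ hp.symm, mul_zero]

/-- The free evolution of amplitudes. -/
def ampEvol (k : ℕ) (t : ℝ) : Amp k →L[ℂ] Amp k := lpTwoMap (phaseMul t k)

theorem norm_phaseMul_le (t : ℝ) (k : ℕ) : ‖phaseMul t k‖ ≤ 1 :=
  norm_lpOneLift_le _ zero_le_one _

theorem norm_ampEvol_le (k : ℕ) (t : ℝ) : ‖ampEvol k t‖ ≤ 1 :=
  (norm_lpTwoMap_le _).trans (norm_phaseMul_le t k)

theorem continuous_phase {k : ℕ} (p : Freq k) : Continuous fun t => phase t p := by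
  unfold phase
  fun_prop

theorem continuous_ampEvol (k : ℕ) (c : Amp k) : Continuous fun t => ampEvol k t c := by
  refine continuous_iff_continuousAt.2 fun t => ?_
  refine tendsto_lpTwoMap (fun s => norm_phaseMul_le s k) (norm_phaseMul_le t k) (fun x => ?_) c
  refine tendsto_lpOneLift _ _ (fun p => ?_) x
  exact ((lp.isometry_single p).continuous.tendsto _).comp ((continuous_phase p).tendsto t)

/-- Strong continuity and the uniform bound 1 on the operators give joint continuity. -/
theorem continuous_ampEvol_uncurry (k : ℕ) : Continuous fun q : ℝ × Amp k => ampEvol k q.1 q.2 := by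
  refine continuous_iff_continuousAt.2 fun ⟨t, c⟩ => ?_
  rw [ContinuousAt, tendsto_iff_norm_sub_tendsto_zero]
  have h1 : Tendsto (fun q : ℝ × Amp k => ‖q.2 - c‖ + ‖ampEvol k q.1 c - ampEvol k t c‖)
      (𝓝 (t, c)) (𝓝 0) := by
    have h2 : Continuous fun q : ℝ × Amp k => ‖q.2 - c‖ + ‖ampEvol k q.1 c - ampEvol k t c‖ :=
      (continuous_snd.sub continuous_const).norm.add
        (((continuous_ampEvol k c).comp continuous_fst).sub continuous_const).norm
    simpa using h2.tendsto (t, c)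
  refine squeeze_zero (fun _ => norm_nonneg _) (fun q => ?_) h1
  calc ‖ampEvol k q.1 q.2 - ampEvol k t c‖
      = ‖ampEvol k q.1 (q.2 - c) + (ampEvol k q.1 c - ampEvol k t c)‖ := by
        rw [map_sub, sub_add_sub_cancel]
    _ ≤ ‖ampEvol k q.1 (q.2 - c)‖ + ‖ampEvol k q.1 c - ampEvol k t c‖ := norm_add_le _ _
    _ ≤ ‖q.2 - c‖ + ‖ampEvol k q.1 c - ampEvol k t c‖ := by
        gcongr
        exact ((ampEvol k q.1).le_of_opNorm_le (norm_ampEvol_le k _) _).trans_eq (one_mul _)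

theorem continuous_ampEvol_comp {X : Type*} [TopologicalSpace X] {k : ℕ} {f : X → ℝ}
    {c : X → Amp k} (hf : Continuous f) (hc : Continuous c) :
    Continuous fun x => ampEvol k (f x) (c x) :=
  Continuous.comp (g := fun q : ℝ × Amp k => ampEvol k q.1 q.2) (f := fun x => (f x, c x))
    (continuous_ampEvol_uncurry k) (hf.prodMk hc)

theorem continuousOn_ampEvol_comp {X : Type*} [TopologicalSpace X] {k : ℕ} {f : X → ℝ}
    {c : X → Amp k} {s : Set X} (hf : ContinuousOn f s) (hc : ContinuousOn c s) :
    ContinuousOn (fun x => ampEvol k (f x) (c x)) s :=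
  Continuous.comp_continuousOn (g := fun q : ℝ × Amp k => ampEvol k q.1 q.2)
    (f := fun x => (f x, c x)) (continuous_ampEvol_uncurry k) (hf.prodMk hc)

theorem freeEvolR_realize (hB : IsBernoulliFamily P h) {α : ℝ} (hα : 0 ≤ α) {k : ℕ} (t : ℝ)
    (c : Amp k) :
    freeEvolR k t (realize hB α hα k c) = realize hB α hα k (ampEvol k t c) := by
  refine rdm_ext fun p => ?_
  have h1 : ampCoeff α p (ampEvol k t c) = phase t p • ampCoeff α p c := by
    refine lp.ext (funext fun A => ?_)
    rw [lp.coeFn_smul, Pi.smul_apply, ampCoeff_apply, ampCoeff_apply, smul_eq_mul,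
      mul_left_comm]
    exact congrArg _ (phaseMul_apply t (c A) p)
  rw [rCoeff_freeEvolR, rCoeff_realize, rCoeff_realize, h1, map_smul]
  rfl

end Random

/-! ### Non-resonant frequencies -/

/-- The ordering condition `|ξ₁| > ⋯ > |ξ_m| > |ξ'₁| > ⋯ > |ξ'_m|`. -/
def IsNonResonant {m : ℕ} (p : Freq m) : Prop :=
  StrictAnti fun i => freqSq (Fin.append p.1 p.2 i)

/-- The set of all components of a frequency. -/
def freqSet {m : ℕ} (p : Freq m) : Finset Z3 := Finset.univ.image (Fin.append p.1 p.2)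

theorem IsNonResonant.injective {m : ℕ} {p : Freq m} (hp : IsNonResonant p) :
    Function.Injective (Fin.append p.1 p.2) :=
  fun _ _ h => StrictAnti.injective hp (congrArg freqSq h)

theorem append_injective {m : ℕ} {p q : Freq m} (h : Fin.append p.1 p.2 = Fin.append q.1 q.2) :
    p = q := by
  refine Prod.ext (funext fun i => ?_) (funext fun i => ?_)
  · have h1 := congrFun h (Fin.castAdd m i)
    rwa [Fin.append_left, Fin.append_left] at h1
  · have h1 := congrFun h (Fin.natAdd m i)
    rwa [Fin.append_right, Fin.append_right] at h1

/-- Equal sets have equal sets of lengths, and a strictly decreasing sequence is determined by its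
range, so the two length sequences coincide. A component of `p` is some component of `q`, and its
length forces the same position. -/
theorem freqSet_injective {m : ℕ} {p q : Freq m} (hp : IsNonResonant p) (hq : IsNonResonant q)
    (h : freqSet p = freqSet q) : p = q := by
  have hr : Set.range (Fin.append p.1 p.2) = Set.range (Fin.append q.1 q.2) := by
    have h1 := congrArg (fun s : Finset Z3 => (s : Set Z3)) h
    simpa [freqSet] using h1
  have h1 : (fun i => -freqSq (Fin.append p.1 p.2 i)) = fun i => -freqSq (Fin.append q.1 q.2 i) := by
    refine (StrictMono.range_inj (fun i j hij => neg_lt_neg (hp hij))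
      (fun i j hij => neg_lt_neg (hq hij))).1 ?_
    have h2 (r : Freq m) : (Set.range fun i => -freqSq (Fin.append r.1 r.2 i))
        = (fun ζ => -freqSq ζ) '' Set.range (Fin.append r.1 r.2) :=
      Set.range_comp (fun ζ => -freqSq ζ) (Fin.append r.1 r.2)
    rw [h2 p, h2 q, hr]
  refine append_injective (funext fun i => ?_)
  obtain ⟨j, hj⟩ : Fin.append p.1 p.2 i ∈ Set.range (Fin.append q.1 q.2) := hr ▸ ⟨i, rfl⟩
  have h3 : freqSq (Fin.append q.1 q.2 j) = freqSq (Fin.append q.1 q.2 i) := by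
    rw [hj]
    exact neg_injective (congrFun h1 i)
  rw [← hj, StrictAnti.injective hq h3]

section Random

variable {Ω : Type u} [MeasurableSpace Ω] {P : Measure Ω} [IsProbabilityMeasure P]
  {h : Z3 → Ω → ℝ}

omit [MeasurableSpace Ω] in
-- The components are distinct, so the Walsh function of their set is the frequency sign itself, and
-- the product is a square.
theorem twist_freqSet {ω : Ω} (hω : ∀ ζ, h ζ ω = 1 ∨ h ζ ω = -1) {m : ℕ} {p : Freq m}
    (hp : IsNonResonant p) : twist h p (freqSet p) ω = 1 := by
  have h1 : walsh h (freqSet p) ω = freqSign h p ω := by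
    rw [walsh, freqSet, Finset.prod_image hp.injective.injOn, Fin.prod_univ_add, freqSign]
    simp only [Fin.append_left, Fin.append_right]
  rw [twist, h1, freqSign_mul_self hω, Complex.ofReal_one]

theorem coeFn_constR {k : ℕ} (σ : DM k) : (constR σ : RDM P k) =ᵐ[P] fun _ => σ :=
  MemLp.coeFn_toLp _

open Classical in
/-- A non-resonant density matrix of finite norm comes from an amplitude of the same norm. -/
theorem exists_amp (hB : IsBernoulliFamily P h) {α : ℝ} (hα : 0 ≤ α) {m : ℕ} {σ : DM m}
    (hσ : ∀ p : Freq m, ¬ IsNonResonant p → dmHat σ p.1 p.2 = 0) (hfin : hNorm α σ < ∞) :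
    ∃ c : Amp m, realize hB α hα m c = constR σ ∧ ‖c‖ₑ = hNorm α σ := by
  let s : {p : Freq m // IsNonResonant p} → Finset Z3 := fun p => freqSet p.1
  have hs : Function.Injective s := fun p q hpq => Subtype.ext (freqSet_injective p.2 q.2 hpq)
  let a : Freq m → ℂ := fun p => (weight α p : ℂ) * dmHat σ p.1 p.2
  -- The amplitude is `f p` at the set of components of `p` and zero at all other sets. By
  -- injectivity of `s` no two frequencies share a set, so each ℓ¹ norm is a single absolute value.
  let f : {p : Freq m // IsNonResonant p} → lp (fun _ : Freq m => ℂ) 1 :=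
    fun p => lp.single 1 p.1 (a p.1)
  have hfn (p) : ‖f p‖ₑ = ‖a p.1‖ₑ := by
    rw [← ofReal_norm, ← ofReal_norm, lp.norm_single (by norm_num)]
  have hsum : ∑' p, ‖f p‖ₑ ^ 2 = hNorm α σ ^ (2 : ℝ) := by
    simp only [hfn]
    rw [hNorm_sq]
    refine tsum_subtype_eq_of_support_subset (s := {p : Freq m | IsNonResonant p})
      (f := fun p => ‖a p‖ₑ ^ 2) fun p hp => ?_
    by_contra hn
    exact hp (by simp [a, hσ p hn])
  have hmem : Memℓp (Function.extend s f 0) 2 := by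
    refine memℓp_gen ?_
    have h1 : (fun A => ‖Function.extend s f 0 A‖ ^ (2 : ℝ≥0∞).toReal)
        = Function.extend s (fun p => ‖f p‖ ^ 2) 0 := by
      funext A
      rw [ENNReal.toReal_ofNat, Real.rpow_two]
      rw [Function.apply_extend (fun x : lp (fun _ : Freq m => ℂ) 1 => ‖x‖ ^ 2)]
      congr 1
      funext B
      simp
    rw [h1, summable_extend_zero hs]
    have h2 := ENNReal.summable_toReal (f := fun p => ‖f p‖ₑ ^ 2)
      (by rw [hsum]; exact (ENNReal.rpow_lt_top_of_nonneg (by norm_num) hfin.ne).ne)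
    simpa using h2
  let c : Amp m := ⟨Function.extend s f 0, hmem⟩
  have hc (A : Finset Z3) : c A = Function.extend s f 0 A := rfl
  have hcs (p) : c (s p) = f p := (hc _).trans (hs.extend_apply f 0 p)
  have hc0 {A : Finset Z3} (hA : ¬ ∃ p, s p = A) : c A = 0 :=
    (hc A).trans (Function.extend_apply' f (0 : Finset Z3 → lp (fun _ : Freq m => ℂ) 1) A hA)
  refine ⟨c, rdm_ext fun q => ?_, ?_⟩
  · refine Lp.ext ?_
    rw [rCoeff_realize]
    by_cases hq : IsNonResonant q
    · have h1 : ampCoeff α q c = lp.single 2 (freqSet q) (dmHat σ q.1 q.2) := by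
        refine lp.ext (funext fun A => ?_)
        rw [ampCoeff_apply]
        by_cases hA : A = freqSet q
        · have h0 : (weight α q : ℂ) ≠ 0 := Complex.ofReal_ne_zero.2 (weight_pos q).ne'
          rw [hA, lp.single_apply_self, show freqSet q = s ⟨q, hq⟩ from rfl, hcs]
          change _ * (lp.single 1 q (a q) : lp (fun _ : Freq m => ℂ) 1) q = _
          rw [lp.single_apply_self, Complex.ofReal_inv, inv_mul_cancel_left₀ h0]
        · rw [lp.single_apply_ne _ _ _ hA]
          by_cases hr : ∃ p, s p = A
          · obtain ⟨p, rfl⟩ := hr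
            have hpq : q ≠ p.1 := fun h2 => hA (by rw [h2])
            rw [hcs]
            change _ * (lp.single 1 p.1 (a p.1) : lp (fun _ : Freq m => ℂ) 1) q = _
            rw [lp.single_apply_ne _ _ _ hpq, mul_zero]
          · rw [hc0 hr, lp.coeFn_zero, Pi.zero_apply, mul_zero]
      have h2 : walshSeries hB q (ampCoeff α q c) = dmHat σ q.1 q.2 • twistLp hB q (freqSet q) := by
        rw [h1]
        refine (hasSum_walshSeries hB q _).unique ?_
        convert hasSum_single (freqSet q) ?_ using 1
        · rw [lp.single_apply_self]
        · intro A hA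
          rw [lp.single_apply_ne _ _ _ hA, zero_smul]
      rw [h2]
      filter_upwards [Lp.coeFn_smul (dmHat σ q.1 q.2) (twistLp hB q (freqSet q)),
        (memLp_twist hB q (freqSet q)).coeFn_toLp, hB.ae_sign, coeFn_constR (P := P) σ,
        coeFn_rCoeff q (constR σ : RDM P m)] with ω h3 h4 h5 h6 h7
      rw [h3, Pi.smul_apply, twistLp, h4, twist_freqSet h5 hq, h7, h6, smul_eq_mul, mul_one]
    · have h1 : ampCoeff α q c = 0 := by
        refine lp.ext (funext fun A => ?_)
        rw [ampCoeff_apply, lp.coeFn_zero, Pi.zero_apply]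
        by_cases hr : ∃ p, s p = A
        · obtain ⟨p, rfl⟩ := hr
          have hpq : q ≠ p.1 := fun h2 => hq (h2 ▸ p.2)
          rw [hcs]
          change _ * (lp.single 1 p.1 (a p.1) : lp (fun _ : Freq m => ℂ) 1) q = _
          rw [lp.single_apply_ne _ _ _ hpq, mul_zero]
        · rw [hc0 hr, lp.coeFn_zero, Pi.zero_apply, mul_zero]
      rw [h1, map_zero]
      filter_upwards [Lp.coeFn_zero ℂ 2 P, coeFn_constR (P := P) σ,
        coeFn_rCoeff q (constR σ : RDM P m)] with ω h2 h3 h4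
      rw [h2, h4, h3, hσ q hq, Pi.zero_apply]
  · have h1 : ‖c‖ₑ ^ (2 : ℝ) = hNorm α σ ^ (2 : ℝ) := by
      rw [ENNReal.rpow_two, enorm_sq_lpTwo, ← hsum, ← tsum_extend_zero hs]
      refine tsum_congr fun A => ?_
      rw [hc, Function.apply_extend (fun x : lp (fun _ : Freq m => ℂ) 1 => ‖x‖ₑ ^ 2)]
      congr 1
      funext B
      simp
    exact (ENNReal.rpow_left_injective (by norm_num : (2 : ℝ) ≠ 0)) h1

end Random

/-! ### Duhamel expansions of amplitudes -/

/-- The integrand of the Duhamel expansion, for amplitudes. -/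
def ampIntegrand (α : ℝ) (hα : 0 ≤ α) (Y : ∀ k, Amp k) :
    (j k : ℕ) → (Fin (j + 1) → ℝ) → Amp k
  | 0, k, s => ampEvol k (s 0) (Y k)
  | j + 1, k, s => ampEvol k (s 0 - s 1)
      (ampCollision α hα k (ampIntegrand α hα Y j (k + 1) (fun i => s i.succ)))

/-- The Duhamel terms, for amplitudes. -/
def ampDuh (α : ℝ) (hα : 0 ≤ α) (Y : ∀ k, Amp k) : (j k : ℕ) → ℝ → Amp k
  | 0, k, t => ampEvol k t (Y k)
  | j + 1, k, t => (-Complex.I) • ∫ s in (0 : ℝ)..t,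
      ampEvol k (t - s) (ampCollision α hα k (ampDuh α hα Y j (k + 1) s))

section Amplitudes

variable {α : ℝ} {hα : 0 ≤ α} {Y : ∀ k, Amp k}

theorem continuous_ampIntegrand (j k : ℕ) : Continuous (ampIntegrand α hα Y j k) := by
  induction j generalizing k with
  | zero =>
    have h1 : ampIntegrand α hα Y 0 k = fun s => ampEvol k (s 0) (Y k) :=
      funext fun s => by rw [ampIntegrand]
    rw [h1]
    exact continuous_ampEvol_comp (continuous_apply 0) continuous_const
  | succ j ih =>
    have h1 : ampIntegrand α hα Y (j + 1) k = fun s => ampEvol k (s 0 - s 1)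
        (ampCollision α hα k (ampIntegrand α hα Y j (k + 1) (fun i => s i.succ))) :=
      funext fun s => by rw [ampIntegrand]
    have h2 : Continuous fun s : Fin (j + 1 + 1) → ℝ => fun i : Fin (j + 1) => s i.succ :=
      continuous_pi fun i => continuous_apply i.succ
    rw [h1]
    exact continuous_ampEvol_comp ((continuous_apply 0).sub (continuous_apply 1))
      ((ampCollision α hα k).continuous.comp ((ih (k + 1)).comp h2))

theorem continuous_ampDuh (j k : ℕ) : Continuous (ampDuh α hα Y j k) := by
  induction j generalizing k with
  | zero =>
    have h1 : ampDuh α hα Y 0 k = fun t => ampEvol k t (Y k) :=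
      funext fun t => by rw [ampDuh]
    rw [h1]
    exact continuous_ampEvol k (Y k)
  | succ j ih =>
    have h1 : ampDuh α hα Y (j + 1) k = fun t => (-Complex.I) • ∫ s in (0 : ℝ)..t,
        ampEvol k (t - s) (ampCollision α hα k (ampDuh α hα Y j (k + 1) s)) :=
      funext fun t => by rw [ampDuh]
    rw [h1]
    refine Continuous.const_smul
      (intervalIntegral.continuous_parametric_intervalIntegral_of_continuous
      (f := fun t s => ampEvol k (t - s) (ampCollision α hα k (ampDuh α hα Y j (k + 1) s)))
      ?_ continuous_id) (-Complex.I)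
    exact continuous_ampEvol_comp (continuous_fst.sub continuous_snd)
      ((ampCollision α hα k).continuous.comp ((ih (k + 1)).comp continuous_snd))

/-- The outermost evolution and collision are bounded operators independent of the inner times, so
they leave the inner integral; this is the recursion of `ampDuh`. -/
theorem smul_simplexIntegral_ampIntegrand (j k : ℕ) (t : ℝ) :
    (-Complex.I) ^ j • simplexIntegral j t
      (fun s => ampIntegrand α hα Y j k (Fin.cons (α := fun _ => ℝ) t s)) =
      ampDuh α hα Y j k t := by
  induction j generalizing k t with
  | zero =>
    rw [pow_zero, one_smul]
    rfl
  | succ j ih =>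
    have h1 (t₁ : ℝ) : simplexIntegral j t₁ (fun s => ampIntegrand α hα Y (j + 1) k
        (Fin.cons (α := fun _ => ℝ) t (Fin.cons (α := fun _ => ℝ) t₁ s)))
        = ampEvol k (t - t₁) (ampCollision α hα k (simplexIntegral j t₁
          (fun s => ampIntegrand α hα Y j (k + 1) (Fin.cons (α := fun _ => ℝ) t₁ s)))) :=
      simplexIntegral_comp_clm
        (((ampEvol k (t - t₁)).comp (ampCollision α hα k)).restrictScalars ℝ) j t₁
        ((continuous_ampIntegrand j (k + 1)).comp
          (Continuous.finCons (A := fun _ => ℝ) continuous_const continuous_id))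
    rw [simplexIntegral, ampDuh, pow_succ', mul_smul, ← intervalIntegral.integral_smul]
    congr 1
    refine intervalIntegral.integral_congr fun t₁ _ => ?_
    simp only [h1]
    rw [← ih, map_smul, map_smul]

/-- A collision onto order k costs 2 · `growth α` · k, and integrating s^j gives the factor 1/(j+1).
The exact product k(k+1)⋯(k+j-1) is relaxed to (k+1)⋯(k+j), whose quotient by j! is a binomial
coefficient. -/
theorem norm_ampDuh_le (j k : ℕ) {t : ℝ} (ht : 0 ≤ t) :
    ‖ampDuh α hα Y j k t‖ ≤
      (2 * growth α) ^ j * t ^ j * (((k + 1).ascFactorial j : ℝ) / j.factorial) * ‖Y (k + j)‖ := by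
  induction j generalizing k t with
  | zero =>
    simpa [ampDuh] using (ampEvol k t).le_of_opNorm_le (norm_ampEvol_le k t) (Y k)
  | succ j ih =>
    have hg := growth_pos α
    -- The two amplitudes live in types indexed by different expressions, so only their norms are
    -- compared.
    have hN : ‖Y (k + 1 + j)‖ = ‖Y (k + (j + 1))‖ := by rw [Nat.add_right_comm, Nat.add_assoc]
    set D : ℝ := 2 * growth α * k * ((2 * growth α) ^ j
      * (((k + 2).ascFactorial j : ℝ) / j.factorial) * ‖Y (k + (j + 1))‖) with hD
    have h1 : ∀ s ∈ Set.Ioc 0 t,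
        ‖ampEvol k (t - s) (ampCollision α hα k (ampDuh α hα Y j (k + 1) s))‖ ≤ D * s ^ j := by
      intro s hs
      refine ((ampEvol k (t - s)).le_of_opNorm_le (norm_ampEvol_le k _) _).trans ?_
      rw [one_mul]
      refine ((ampCollision α hα k).le_of_opNorm_le (norm_ampCollision_le hα k) _).trans ?_
      have h2 := mul_le_mul_of_nonneg_left (ih (k + 1) hs.1.le)
        (show 0 ≤ 2 * growth α * k by positivity)
      rw [hN] at h2
      refine h2.trans_eq ?_
      rw [hD]
      ring
    have h3 : ‖∫ s in (0 : ℝ)..t,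
        ampEvol k (t - s) (ampCollision α hα k (ampDuh α hα Y j (k + 1) s))‖
        ≤ D * (t ^ (j + 1) / (j + 1)) := by
      refine (intervalIntegral.norm_integral_le_of_norm_le ht
        (Eventually.of_forall h1) ((by fun_prop : Continuous fun s : ℝ => D * s ^ j).intervalIntegrable
          _ _)).trans_eq ?_
      rw [intervalIntegral.integral_const_mul, integral_pow]
      simp
    have h4 : (k : ℝ) * (k + 2).ascFactorial j ≤ (k + 1).ascFactorial (j + 1) := by
      have h5 := Nat.succ_ascFactorial (k + 1) j
      rw [← Nat.ascFactorial_succ] at h5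
      rw [← h5]
      push_cast
      exact mul_le_mul_of_nonneg_right (by linarith) (Nat.cast_nonneg _)
    rw [ampDuh, norm_smul, norm_neg, Complex.norm_I, one_mul]
    refine h3.trans ?_
    have h6 : (0 : ℝ) < j.factorial := by exact_mod_cast j.factorial_pos
    have h7 : (2 * growth α) ^ (j + 1) * t ^ (j + 1)
        * (((k + 1).ascFactorial (j + 1) : ℝ) / (j + 1).factorial) * ‖Y (k + (j + 1))‖
        - D * (t ^ (j + 1) / (j + 1))
        = (2 * growth α) ^ (j + 1) * t ^ (j + 1) * ‖Y (k + (j + 1))‖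
          / (j.factorial * (j + 1)) * ((k + 1).ascFactorial (j + 1)
            - (k : ℝ) * (k + 2).ascFactorial j) := by
      rw [hD, Nat.factorial_succ]
      push_cast
      field_simp
      ring
    rw [← sub_nonneg, h7]
    exact mul_nonneg (by positivity) (sub_nonneg.2 h4)

/-- In the bound 2^(k+j) for the binomial, 2^j joins (2 · `growth α` · t)^j, which is the origin of
the constant 4 · `growth α`; the remaining 2^k is paid by the ratio of the two exponential weights.
-/
theorem norm_ampDuh_le_of_mem {ξ' T : ℝ} (hξ' : 0 < ξ') (hT : 4 * growth α * T ≤ ξ')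
    (j k : ℕ) {t : ℝ} (ht : t ∈ Set.Icc 0 T) :
    ‖ampDuh α hα Y j k t‖ ≤ (2 / ξ') ^ k * (ξ' ^ (k + j) * ‖Y (k + j)‖) := by
  have hg := growth_pos α
  have ht0 := ht.1
  have h1 : ((k + 1).ascFactorial j : ℝ) / j.factorial ≤ 2 ^ (k + j) := by
    rw [Nat.ascFactorial_eq_factorial_mul_choose, Nat.cast_mul, mul_div_cancel_left₀ _
      (by exact_mod_cast j.factorial_ne_zero)]
    exact_mod_cast Nat.choose_le_two_pow _ _
  have h2 : 4 * growth α * t ≤ ξ' :=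
    (mul_le_mul_of_nonneg_left ht.2 (by positivity)).trans hT
  calc ‖ampDuh α hα Y j k t‖
      ≤ (2 * growth α) ^ j * t ^ j * (((k + 1).ascFactorial j : ℝ) / j.factorial)
        * ‖Y (k + j)‖ := norm_ampDuh_le j k ht0
    _ ≤ (2 * growth α) ^ j * t ^ j * 2 ^ (k + j) * ‖Y (k + j)‖ := by gcongr
    _ = 2 ^ k * (4 * growth α * t) ^ j * ‖Y (k + j)‖ := by
        rw [show 4 * growth α * t = 2 * (2 * growth α * t) by ring, mul_pow, mul_pow, pow_add]
        ring
    _ ≤ 2 ^ k * ξ' ^ j * ‖Y (k + j)‖ := by gcongr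
    _ = _ := by
        rw [div_pow, pow_add]
        field_simp

/-! ### Summation of the Duhamel series -/

variable (α hα Y) in
/-- The sum of the Duhamel expansion, for amplitudes. -/
def ampSol (k : ℕ) (t : ℝ) : Amp k := ∑' j, ampDuh α hα Y j k t

variable {ξ' T : ℝ}

theorem summable_shift (hY : Summable fun m => ξ' ^ m * ‖Y m‖) (k : ℕ) :
    Summable fun j => (2 / ξ') ^ k * (ξ' ^ (k + j) * ‖Y (k + j)‖) := by
  refine Summable.mul_left _ ?_
  refine ((summable_nat_add_iff k).2 hY).congr fun j => ?_
  rw [Nat.add_comm]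

theorem summable_ampDuh (hξ' : 0 < ξ') (hT : 4 * growth α * T ≤ ξ')
    (hY : Summable fun m => ξ' ^ m * ‖Y m‖) (k : ℕ) {t : ℝ} (ht : t ∈ Set.Icc 0 T) :
    Summable fun j => ampDuh α hα Y j k t :=
  Summable.of_norm_bounded (summable_shift hY k) fun j => norm_ampDuh_le_of_mem hξ' hT j k ht

theorem continuousOn_ampSol (hξ' : 0 < ξ') (hT : 4 * growth α * T ≤ ξ')
    (hY : Summable fun m => ξ' ^ m * ‖Y m‖) (k : ℕ) :
    ContinuousOn (ampSol α hα Y k) (Set.Icc 0 T) :=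
  continuousOn_tsum (fun j => (continuous_ampDuh j k).continuousOn) (summable_shift hY k)
    fun j _ ht => norm_ampDuh_le_of_mem hξ' hT j k ht

theorem continuousOn_ampCollision_ampSol (hξ' : 0 < ξ') (hT : 4 * growth α * T ≤ ξ')
    (hY : Summable fun m => ξ' ^ m * ‖Y m‖) (k : ℕ) (t : ℝ) :
    ContinuousOn (fun s => ampEvol k (t - s) (ampCollision α hα k (ampSol α hα Y (k + 1) s)))
      (Set.Icc 0 T) :=
  continuousOn_ampEvol_comp (continuous_const.sub continuous_id).continuousOn
    ((ampCollision α hα k).continuous.comp_continuousOn (continuousOn_ampSol hξ' hT hY (k + 1)))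

/-- Summation over `j` of the recursion defining `ampDuh`. The majorants are constant in time and
summable, which justifies exchanging sum and integral. -/
theorem ampSol_eq (hξ' : 0 < ξ') (hT : 4 * growth α * T ≤ ξ')
    (hY : Summable fun m => ξ' ^ m * ‖Y m‖) (k : ℕ) {t : ℝ} (ht : t ∈ Set.Icc 0 T) :
    ampSol α hα Y k t = ampEvol k t (Y k) - Complex.I • ∫ s in (0 : ℝ)..t,
      ampEvol k (t - s) (ampCollision α hα k (ampSol α hα Y (k + 1) s)) := by
  have hg := growth_pos α
  have hmem {s : ℝ} (hs : s ∈ Set.uIoc 0 t) : s ∈ Set.Icc 0 T := by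
    rw [Set.uIoc_of_le ht.1] at hs
    exact ⟨hs.1.le, hs.2.trans ht.2⟩
  let b (j : ℕ) : ℝ := 2 * growth α * k
    * ((2 / ξ') ^ (k + 1) * (ξ' ^ (k + 1 + j) * ‖Y (k + 1 + j)‖))
  have hb : Summable b := (summable_shift hY (k + 1)).mul_left _
  have h1 : HasSum (fun j => ∫ s in (0 : ℝ)..t,
      ampEvol k (t - s) (ampCollision α hα k (ampDuh α hα Y j (k + 1) s)))
      (∫ s in (0 : ℝ)..t, ampEvol k (t - s) (ampCollision α hα k (ampSol α hα Y (k + 1) s))) := by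
    refine intervalIntegral.hasSum_integral_of_dominated_convergence (fun j _ => b j)
      (fun j => ?_) (fun j => Eventually.of_forall fun s hs => ?_)
      (Eventually.of_forall fun s _ => hb) (by simp)
      (Eventually.of_forall fun s hs => ?_)
    · refine Continuous.aestronglyMeasurable ?_
      exact continuous_ampEvol_comp (continuous_const.sub continuous_id)
        ((ampCollision α hα k).continuous.comp (continuous_ampDuh j (k + 1)))
    · refine ((ampEvol k (t - s)).le_of_opNorm_le (norm_ampEvol_le k _) _).trans ?_
      rw [one_mul]
      refine ((ampCollision α hα k).le_of_opNorm_le (norm_ampCollision_le hα k) _).trans ?_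
      exact mul_le_mul_of_nonneg_left (norm_ampDuh_le_of_mem hξ' hT j (k + 1) (hmem hs))
        (by positivity)
    · exact (summable_ampDuh hξ' hT hY (k + 1) (hmem hs)).hasSum.mapL
        ((ampEvol k (t - s)).comp (ampCollision α hα k))
  rw [ampSol, (summable_ampDuh hξ' hT hY k ht).tsum_eq_zero_add, sub_eq_add_neg, ← neg_smul]
  refine congrArg _ ?_
  exact (h1.const_smul (-Complex.I)).tsum_eq

end Amplitudes

section Random

variable {Ω : Type u} [MeasurableSpace Ω] {P : Measure Ω} [IsProbabilityMeasure P]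
  {h : Z3 → Ω → ℝ} {α : ℝ} {hα : 0 ≤ α} {Y : ∀ k, Amp k} {Γ₀ : ∀ k, DM k}

/-! ### Duhamel expansions of random density matrices -/

theorem duhIntegrand_eq_realize (hB : IsBernoulliFamily P h)
    (hY : ∀ k, 1 ≤ k → realize hB α hα k (Y k) = constR (Γ₀ k)) (j : ℕ) {k : ℕ} (hk : 1 ≤ k)
    (s : Fin (j + 1) → ℝ) :
    (duhIntegrand h Γ₀ j k s : RDM P k) = realize hB α hα k (ampIntegrand α hα Y j k s) := by
  induction j generalizing k with
  | zero => rw [duhIntegrand, ← hY k hk, freeEvolR_realize, ampIntegrand]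
  | succ j ih =>
    rw [duhIntegrand, ih (Nat.le_add_left 1 k), collision_realize, freeEvolR_realize, ampIntegrand]

theorem duhamelDefined_of_realize (hB : IsBernoulliFamily P h)
    (hY : ∀ k, 1 ≤ k → realize hB α hα k (Y k) = constR (Γ₀ k)) :
    DuhamelDefined (P := P) h Γ₀ := by
  intro j k hk
  constructor
  · intro s
    rw [duhIntegrand_eq_realize hB hY j (Nat.le_add_left 1 k)]
    exact collisionDefined_realize hB hα _
  · simp only [duhIntegrand_eq_realize hB hY j hk]
    exact (realize hB α hα k).continuous.comp (continuous_ampIntegrand j k)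

theorem duh_eq_realize (hB : IsBernoulliFamily P h)
    (hY : ∀ k, 1 ≤ k → realize hB α hα k (Y k) = constR (Γ₀ k)) (j : ℕ) {k : ℕ} (hk : 1 ≤ k)
    (t : ℝ) : (duh h Γ₀ j k t : RDM P k) = realize hB α hα k (ampDuh α hα Y j k t) := by
  rw [duh, ← smul_simplexIntegral_ampIntegrand, map_smul]
  simp only [duhIntegrand_eq_realize hB hY j hk]
  congr 1
  exact simplexIntegral_comp_clm ((realize hB α hα k).restrictScalars ℝ) j t
    ((continuous_ampIntegrand j k).comp
      (Continuous.finCons (A := fun _ => ℝ) continuous_const continuous_id))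

theorem rNorm_zero (hB : IsBernoulliFamily P h) (hα : 0 ≤ α) (k : ℕ) :
    rNorm α (0 : RDM P k) = 0 := by
  have h1 := rNorm_realize_le hB hα (0 : Amp k)
  rw [map_zero, enorm_zero] at h1
  exact le_antisymm h1 zero_le

omit [IsProbabilityMeasure P] in
theorem rNorm_neg (k : ℕ) (σ : RDM P k) : rNorm α (-σ) = rNorm α σ := by
  refine ENNReal.rpow_left_injective (by norm_num : (2 : ℝ) ≠ 0) ?_
  simp only [rNorm_sq, map_neg, enorm_neg]

/-! ### Tails of the expansion and the Duhamel formula -/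

variable {ξ ξ' T : ℝ}

/-- The terms of the Duhamel expansion that involve data of order greater than `N` are bounded by
the corresponding part of the norm of the data. -/
theorem enorm_tail_le (hξ : 0 < ξ) (hξ' : 0 < ξ') (hT : 4 * growth α * T ≤ ξ')
    (N k : ℕ) {t : ℝ} (ht : t ∈ Set.Icc 0 T) :
    ENNReal.ofReal ξ ^ (k + 1) * ‖∑' j, ampDuh α hα Y (j + (N - k)) (k + 1) t‖ₑ ≤
      ENNReal.ofReal (2 * ξ / ξ') ^ (k + 1) *
        ∑' m, ENNReal.ofReal (ξ' ^ (m + N + 1) * ‖Y (m + N + 1)‖) := by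
  let x (m : ℕ) : ℝ≥0∞ := ENNReal.ofReal (ξ' ^ (m + 1) * ‖Y (m + 1)‖)
  have h1 (j : ℕ) : ENNReal.ofReal ξ ^ (k + 1) * ‖ampDuh α hα Y j (k + 1) t‖ₑ ≤
      ENNReal.ofReal (2 * ξ / ξ') ^ (k + 1) * x (k + j) := by
    have h2 := mul_le_mul_of_nonneg_left (norm_ampDuh_le_of_mem (hα := hα) (Y := Y) hξ' hT j
      (k + 1) ht) (pow_nonneg hξ.le (k + 1))
    have h3 := ENNReal.ofReal_le_ofReal h2
    rw [ENNReal.ofReal_mul (by positivity), ofReal_norm, ENNReal.ofReal_pow hξ.le,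
      ← mul_assoc, ← mul_pow, ENNReal.ofReal_mul (by positivity),
      ENNReal.ofReal_pow (by positivity), Nat.add_right_comm k 1 j] at h3
    rwa [show 2 * ξ / ξ' = ξ * (2 / ξ') by ring]
  calc ENNReal.ofReal ξ ^ (k + 1) * ‖∑' j, ampDuh α hα Y (j + (N - k)) (k + 1) t‖ₑ
      ≤ ENNReal.ofReal ξ ^ (k + 1) * ∑' j, ‖ampDuh α hα Y (j + (N - k)) (k + 1) t‖ₑ :=
        mul_le_mul_right enorm_tsum_le_tsum_enorm _
    _ ≤ ENNReal.ofReal (2 * ξ / ξ') ^ (k + 1) * ∑' j, x (k + (j + (N - k))) := by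
        rw [← ENNReal.tsum_mul_left, ← ENNReal.tsum_mul_left]
        exact ENNReal.tsum_le_tsum fun j => h1 _
    _ ≤ ENNReal.ofReal (2 * ξ / ξ') ^ (k + 1) * ∑' m, x (m + N) := by
        refine mul_le_mul_right ?_ _
        -- With truncated subtraction k + (N - k) = N + (k - N), both being the maximum of k and N.
        -- So the tail is a subfamily of the terms of the data beyond `N`.
        have h4 (j : ℕ) : x (k + (j + (N - k))) = (fun m => x (m + N)) (j + (k - N)) := by
          change x _ = x _
          congr 1
          omega
        simp only [h4]
        exact ENNReal.tsum_comp_le_tsum_of_injective (add_left_injective (k - N)) _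

/-- Only norms of `Λ` are prescribed, so that one estimate covers the error of the truncation, known
up to sign, and the solution itself, where `N` is 0. -/
theorem seqNormR_tail_le (hB : IsBernoulliFamily P h) (hξ : 0 < ξ) (hξ' : 0 < ξ')
    (hT : 4 * growth α * T ≤ ξ') (N : ℕ) {t : ℝ} (ht : t ∈ Set.Icc 0 T) {Λ : ∀ k, RDM P k}
    (hΛ : ∀ k, rNorm α (Λ (k + 1)) =
      rNorm α (realize hB α hα (k + 1) (∑' j, ampDuh α hα Y (j + (N - k)) (k + 1) t))) :
    seqNormR α ξ Λ ≤ (∑' k : ℕ, ENNReal.ofReal (2 * ξ / ξ') ^ (k + 1)) *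
        ∑' m, ENNReal.ofReal (ξ' ^ (m + N + 1) * ‖Y (m + N + 1)‖) := by
  rw [seqNormR, ← ENNReal.tsum_mul_right]
  refine ENNReal.tsum_le_tsum fun k => ?_
  rw [hΛ]
  exact (mul_le_mul_right (rNorm_realize_le hB hα _) _).trans
    (enorm_tail_le hξ hξ' hT N k ht)

theorem truncated_sub_realize (hB : IsBernoulliFamily P h)
    (hY : ∀ k, 1 ≤ k → realize hB α hα k (Y k) = constR (Γ₀ k)) (hξ' : 0 < ξ')
    (hT : 4 * growth α * T ≤ ξ') (hs : Summable fun m => ξ' ^ m * ‖Y m‖) (N k : ℕ) {t : ℝ}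
    (ht : t ∈ Set.Icc 0 T) :
    truncated h Γ₀ N t (k + 1) - realize hB α hα (k + 1) (ampSol α hα Y (k + 1) t) =
      -realize hB α hα (k + 1) (∑' j, ampDuh α hα Y (j + (N - k)) (k + 1) t) := by
  have h1 : (truncated h Γ₀ N t (k + 1) : RDM P (k + 1)) = realize hB α hα (k + 1)
      (∑ j ∈ Finset.range (N - k), ampDuh α hα Y j (k + 1) t) := by
    rw [truncated, map_sum]
    -- The entry of order k+1 contains N - k terms. If k+1 > N this number is 0, in agreement with
    -- the value of the truncation.
    split_ifs with hk
    · rw [show N - (k + 1) + 1 = N - k by omega]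
      exact Finset.sum_congr rfl fun j _ => duh_eq_realize hB hY j (Nat.le_add_left 1 k) t
    · rw [show N - k = 0 by omega, Finset.sum_range_zero]
  rw [h1, ampSol, ← (summable_ampDuh hξ' hT hs (k + 1) ht).sum_add_tsum_nat_add (N - k), map_add]
  abel

/-- `realize` intertwines evolution, collision and time integral with their counterparts on
amplitudes, so this is `ampSol_eq`. It holds at every time of the interval. -/
theorem defect_eq_zero (hB : IsBernoulliFamily P h)
    (hY : ∀ k, 1 ≤ k → realize hB α hα k (Y k) = constR (Γ₀ k)) (hξ' : 0 < ξ')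
    (hT : 4 * growth α * T ≤ ξ') (hs : Summable fun m => ξ' ^ m * ‖Y m‖) {k : ℕ} (hk : 1 ≤ k)
    {t : ℝ} (ht : t ∈ Set.Icc 0 T) :
    defect h Γ₀ (fun t k => realize hB α hα k (ampSol α hα Y k t)) t k = 0 := by
  have hint : IntervalIntegrable (fun s => ampEvol k (t - s)
      (ampCollision α hα k (ampSol α hα Y (k + 1) s))) volume 0 t :=
    ((continuousOn_ampCollision_ampSol hξ' hT hs k t).mono
      (by rw [Set.uIcc_of_le ht.1]; exact Set.Icc_subset_Icc_right ht.2)).intervalIntegrable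
  have h1 : ∫ s in (0 : ℝ)..t, freeEvolR k (t - s)
      (collision h k (realize hB α hα (k + 1) (ampSol α hα Y (k + 1) s)))
      = realize hB α hα k (∫ s in (0 : ℝ)..t, ampEvol k (t - s)
        (ampCollision α hα k (ampSol α hα Y (k + 1) s))) := by
    simp only [collision_realize, freeEvolR_realize]
    exact (realize hB α hα k).intervalIntegral_comp_comm hint
  rw [defect, h1, ← hY k hk, freeEvolR_realize, ampSol_eq hξ' hT hs k ht, map_sub, map_smul]
  abel

end Random

/-! ### Amplitudes of the data, and norms of sequences -/

section Random

variable {Ω : Type u} [MeasurableSpace Ω] {P : Measure Ω} [IsProbabilityMeasure P]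
  {h : Z3 → Ω → ℝ} {α : ℝ} {Γ₀ : ∀ k, DM k}

theorem exists_amp_seq (hB : IsBernoulliFamily P h) (hα : 0 ≤ α) (hΓ : NonResonant α Γ₀) :
    ∃ Y : ∀ k, Amp k, ∀ k, 1 ≤ k →
      realize hB α hα k (Y k) = constR (Γ₀ k) ∧ ‖Y k‖ₑ = hNorm α (Γ₀ k) := by
  obtain ⟨hsupp, C, -, hC⟩ := hΓ
  have h1 (k : ℕ) : ∃ c : Amp k, 1 ≤ k →
      realize hB α hα k c = constR (Γ₀ k) ∧ ‖c‖ₑ = hNorm α (Γ₀ k) := by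
    by_cases hk : 1 ≤ k
    · obtain ⟨c, hc⟩ := exists_amp hB hα (fun p hp => hsupp k hk p.1 p.2 hp)
        ((hC k hk).trans_lt (ENNReal.pow_lt_top ENNReal.ofReal_lt_top))
      exact ⟨c, fun _ => hc⟩
    -- The entry of order 0 is irrelevant; any amplitude will do.
    · exact ⟨0, fun h2 => absurd h2 hk⟩
  choose Y hY using h1
  exact ⟨Y, hY⟩

theorem seqNorm_eq_tsum {ξ' : ℝ} (hξ' : 0 < ξ') {Y : ∀ k, Amp k}
    (hY : ∀ k, 1 ≤ k → ‖Y k‖ₑ = hNorm α (Γ₀ k)) :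
    seqNorm α ξ' Γ₀ = ∑' m, ENNReal.ofReal (ξ' ^ (m + 1) * ‖Y (m + 1)‖) := by
  refine tsum_congr fun m => ?_
  rw [ENNReal.ofReal_mul (by positivity), ENNReal.ofReal_pow hξ'.le, ofReal_norm,
    hY (m + 1) (Nat.le_add_left 1 m)]

omit [IsProbabilityMeasure P] in
theorem timeNorm_le {T ξ : ℝ} {Γ : ℝ → ∀ k, RDM P k} {c : ℝ≥0∞}
    (hc : ∀ t ∈ Set.Icc 0 T, seqNormR α ξ (Γ t) ≤ c) : timeNorm T α ξ Γ ≤ c :=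
  essSup_le_of_ae_le c ((ae_restrict_mem measurableSet_Icc).mono hc)

theorem tsum_pow_succ_lt_top {r : ℝ≥0∞} (hr : r < 1) : ∑' k : ℕ, r ^ (k + 1) < ∞ := by
  simp only [pow_succ']
  rw [ENNReal.tsum_mul_left, ENNReal.tsum_geometric]
  exact ENNReal.mul_lt_top (hr.trans ENNReal.one_lt_top)
    (ENNReal.inv_lt_top.2 (tsub_pos_of_lt hr))

end Random

end

end RandGP

/-! ### Proof of the theorem -/

theorem theorem4p17 (α : ℝ) (hα : 0 ≤ α) :
    ∃ C₁ C₂ : ℝ, 0 < C₁ ∧ 0 < C₂ ∧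
      ∀ ξ ξ' : ℝ, 0 < ξ → ξ < ξ' → C₂ * ξ / ξ' < 1 →
        ∃ K : ℝ≥0, ∀ T : ℝ, 0 < T → C₁ * T / ξ' < 1 →
          ∀ (Ω : Type u) [MeasurableSpace Ω] (P : Measure Ω) [IsProbabilityMeasure P]
            (h : RandGP.Z3 → Ω → ℝ), RandGP.IsBernoulliFamily P h →
          ∀ Γ₀ : (∀ k, RandGP.DM k), RandGP.seqNorm α ξ' Γ₀ < ∞ → RandGP.NonResonant α Γ₀ →
            RandGP.DuhamelDefined (P := P) h Γ₀ ∧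
            ∃ Γ : ℝ → ∀ k, RandGP.RDM P k,
              RandGP.MemTimeSpace T α ξ Γ ∧
              Tendsto (fun N : ℕ => RandGP.timeNorm T α ξ
                (fun t k => RandGP.truncated h Γ₀ N t k - Γ t k)) atTop (𝓝 0) ∧
              RandGP.timeNorm T α ξ Γ ≤ K * RandGP.seqNorm α ξ' Γ₀ ∧
              RandGP.CollisionTermDefined h T Γ ∧
              (∀ ξ₀ : ℝ, 0 < ξ₀ →
                RandGP.timeNorm T α ξ₀ (RandGP.defect h Γ₀ Γ) = 0) ∧
              (∀ᵐ t ∂(volume.restrict (Set.Icc 0 T)), ∀ k, 1 ≤ k →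
                RandGP.rNorm α (RandGP.defect h Γ₀ Γ t k) = 0) := by

  -- The constants are those of `norm_ampDuh_le_of_mem`; `K` is the geometric series of ratio 2ξ/ξ',
  -- finite because C₂ = 2.
  refine ⟨4 * RandGP.growth α, 2, mul_pos four_pos (RandGP.growth_pos α), two_pos,
    fun ξ ξ' hξ hξξ' hC₂ => ⟨(∑' k : ℕ, ENNReal.ofReal (2 * ξ / ξ') ^ (k + 1)).toNNReal, ?_⟩⟩
  intro T hT hC₁ Ω _ P _ h hB Γ₀ hfin hΓ
  have hξ' : 0 < ξ' := hξ.trans hξξ'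
  have hT' : 4 * RandGP.growth α * T ≤ ξ' := ((div_lt_one hξ').1 hC₁).le
  have hK : ∑' k : ℕ, ENNReal.ofReal (2 * ξ / ξ') ^ (k + 1) < ∞ :=
    RandGP.tsum_pow_succ_lt_top (by rwa [ENNReal.ofReal_lt_one])
  obtain ⟨Y, hYΓ⟩ := RandGP.exists_amp_seq hB hα hΓ
  have hY : ∀ k, 1 ≤ k → RandGP.realize hB α hα k (Y k) = RandGP.constR (Γ₀ k) :=
    fun k hk => (hYΓ k hk).1
  have hseq := RandGP.seqNorm_eq_tsum hξ' fun k hk => (hYΓ k hk).2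
  have hs : Summable fun m => ξ' ^ m * ‖Y m‖ := by
    refine (summable_nat_add_iff 1).1 ?_
    have h1 := ENNReal.summable_toReal (hseq ▸ hfin.ne)
    refine h1.congr fun m => ENNReal.toReal_ofReal (by positivity)
  let Γ : ℝ → ∀ k, RandGP.RDM P k := fun t k =>
    RandGP.realize hB α hα k (RandGP.ampSol α hα Y k t)
  have hbound : RandGP.timeNorm T α ξ Γ ≤
      (∑' k : ℕ, ENNReal.ofReal (2 * ξ / ξ') ^ (k + 1)) * RandGP.seqNorm α ξ' Γ₀ := by
    refine RandGP.timeNorm_le fun t ht => ?_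
    rw [hseq]
    refine RandGP.seqNormR_tail_le (hα := hα) (Y := Y) hB hξ hξ' hT' 0 ht fun k => ?_
    -- For N = 0 the tail is the entire series, that is, `Γ` itself.
    simp only [Nat.zero_sub, Nat.add_zero]
    rfl
  have hdefect : ∀ t ∈ Set.Icc 0 T, ∀ k, 1 ≤ k →
      RandGP.rNorm α (RandGP.defect h Γ₀ Γ t k) = 0 := by
    intro t ht k hk
    rw [RandGP.defect_eq_zero hB hY hξ' hT' hs hk ht]
    exact RandGP.rNorm_zero hB hα k
  refine ⟨RandGP.duhamelDefined_of_realize hB hY, Γ, ⟨fun k _ => ?_, ?_⟩, ?_, ?_, ⟨?_, ?_⟩, ?_, ?_⟩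
  · exact ((RandGP.realize hB α hα k).continuous.comp_continuousOn
      (RandGP.continuousOn_ampSol hξ' hT' hs k)).aestronglyMeasurable measurableSet_Icc
  · exact hbound.trans_lt (ENNReal.mul_lt_top hK hfin)
  -- The majorant is `K` times the tail beyond `N` of the convergent series for the norm of the
  -- data.
  · have h1 := ENNReal.Tendsto.const_mul (a := ∑' k : ℕ, ENNReal.ofReal (2 * ξ / ξ') ^ (k + 1))
      (ENNReal.tendsto_sum_nat_add (fun m => ENNReal.ofReal (ξ' ^ (m + 1) * ‖Y (m + 1)‖))
        (hseq ▸ hfin.ne)) (Or.inr hK.ne)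
    rw [mul_zero] at h1
    refine tendsto_of_tendsto_of_tendsto_of_le_of_le tendsto_const_nhds h1 (fun _ => zero_le)
      fun N => RandGP.timeNorm_le fun t ht => ?_
    refine RandGP.seqNormR_tail_le (hα := hα) (Y := Y) hB hξ hξ' hT' N ht fun k => ?_
    rw [RandGP.truncated_sub_realize hB hY hξ' hT' hs N k ht, RandGP.rNorm_neg]
  · rwa [ENNReal.coe_toNNReal hK.ne]
  · exact Eventually.of_forall fun t k _ => RandGP.collisionDefined_realize hB hα _
  · intro t ht k _
    simp only [Γ, RandGP.collision_realize, RandGP.freeEvolR_realize]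
    refine ContinuousOn.intervalIntegrable ((RandGP.realize hB α hα k).continuous.comp_continuousOn
      ((RandGP.continuousOn_ampCollision_ampSol hξ' hT' hs k t).mono ?_))
    rw [Set.uIcc_of_le ht.1]
    exact Set.Icc_subset_Icc_right ht.2
  · intro ξ₀ _
    refine le_antisymm (RandGP.timeNorm_le fun t ht => ?_) zero_le
    rw [RandGP.seqNormR]
    exact (ENNReal.tsum_eq_zero.2 fun k => by
      rw [hdefect t ht (k + 1) (Nat.le_add_left 1 k), mul_zero]).le
  · exact (ae_restrict_mem measurableSet_Icc).mono hdefect
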